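/- Fix a prime $p>2$. A \emph{$\sigma$-pro-$p$-group} is a pro-$p$-group $G$ with a continuous action of a group $\{1,\sigma\}$ of order $2$ by automorphisms; $G^-:=\{a\in G\mid {}^\sigma a=a^{-1}\}$ is the set of its \emph{odd} elements, and a \emph{$\sigma$-isomorphism} is a $\sigma$-equivariant isomorphism of topological groups. For $n\ge 0$ let $F_n$ be the free pro-$p$-group on $x_1,\dots,x_n$, with the action of $\sigma$ for which ${}^\sigma x_i=x_i^{-1}$ for all $i$. For $r=(r_1,\dots,r_n)\in(F_n^-)^n$ let $N_r$ be the closed normal subgroup of $F_n$ generated by all conjugates of $r_1,\dots,r_n$; it is $\sigma$-invariant, so $F_n/N_r$ is again a $\sigma$-pro-$p$-group. Let $H^i(G,\mathbb{F}_p)$ denote continuous cohomology with trivial action of $G$ on $\mathbb{F}_p$, with the action of $\sigma$ induced by its action on $G$. \textbf{Proposition.} For any $\sigma$-pro-$p$-group $G$ the following conditions are equivalent: \begin{enumerate} \item[(a)] $G$ is $\sigma$-isomorphic to $F_n/N_r$ for some $n\ge 0$ and some $r\in(F_n^-)^n$. \item[(b)] $\dim_{\mathbb{F}_p} H^2(G,\mathbb{F}_p)\le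 \dim_{\mathbb{F}_p} H^1(G,\mathbb{F}_p)<\infty$, and $\sigma$ acts by $-1$ on both spaces. \end{enumerate} Moreover, if these conditions hold, then (a) holds with $n=d_G:=\dim_{\mathbb{F}_p}H^1(G,\mathbb{F}_p)$. -/

import Mathlib

/-! ### Pro-`p`-groups with an involution -/

/-- A profinite group (a compact totally disconnected topological group) is a pro-`p`-group if
all its finite continuous quotients are `p`-groups. -/
class IsProP (p : ℕ) (G : Type*) [Group G] [TopologicalSpace G] [IsTopologicalGroup G] : Prop where
  compactSpace : CompactSpace G
  totallyDisconnectedSpace : TotallyDisconnectedSpace G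
  isPGroup_quotient : ∀ U : OpenNormalSubgroup G, IsPGroup p (G ⧸ U.toSubgroup)

/-- A continuous action of a group `{1, σ}` of order two on a topological group `G` by group
automorphisms, given by the action of `σ`. A `σ`-pro-`p`-group is a pro-`p`-group together with
such an action. -/
structure SigmaAction (G : Type*) [Group G] [TopologicalSpace G] where
  /-- The map `a ↦ σ a`. -/
  sigma : G →ₜ* G
  sigma_sigma : ∀ a : G, sigma (sigma a) = a

namespace SigmaAction

variable {G H : Type*} [Group G] [TopologicalSpace G] [Group H] [TopologicalSpace H]

/-- The odd part `G⁻ = {a ∈ G | σ a = a⁻¹}`. -/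
def oddPart (s : SigmaAction G) : Set G := {a | s.sigma a = a⁻¹}

/-- `G` and `H` are `σ`-isomorphic: there is a `σ`-equivariant topological isomorphism. -/
def Isomorphic (s : SigmaAction G) (t : SigmaAction H) : Prop :=
  ∃ e : G ≃ₜ* H, ∀ a : G, e (s.sigma a) = t.sigma (e a)

/-- The closed normal subgroup of `G` generated by the conjugates of the entries of `r`. -/
def closedNormalClosure [IsTopologicalGroup G] {n : ℕ} (r : Fin n → G) : Subgroup G :=
  (Subgroup.normalClosure (Set.range r)).topologicalClosure

instance [IsTopologicalGroup G] {n : ℕ} (r : Fin n → G) : (closedNormalClosure r).Normal :=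
  Subgroup.is_normal_topologicalClosure _

theorem closedNormalClosure_le_comap [IsTopologicalGroup G] (s : SigmaAction G) {n : ℕ}
    {r : Fin n → G} (hr : ∀ i, r i ∈ s.oddPart) :
    closedNormalClosure r ≤ (closedNormalClosure r).comap (s.sigma : G →* G) := by
  refine Subgroup.topologicalClosure_minimal _ (Subgroup.normalClosure_le_normal ?_) ?_
  · rintro _ ⟨i, rfl⟩
    have h : s.sigma (r i) = (r i)⁻¹ := hr i
    change s.sigma (r i) ∈ closedNormalClosure r
    rw [h]
    exact inv_mem (Subgroup.le_topologicalClosure _ (Subgroup.subset_normalClosure ⟨i, rfl⟩))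
  · exact (Subgroup.isClosed_topologicalClosure _).preimage s.sigma.continuous_toFun

/-- The action of `σ` induced on the quotient of `G` by the closed normal subgroup generated by
all conjugates of finitely many odd elements `r 0, …, r (n - 1)`. -/
def quotient [IsTopologicalGroup G] (s : SigmaAction G) {n : ℕ} (r : Fin n → G)
    (hr : ∀ i, r i ∈ s.oddPart) : SigmaAction (G ⧸ closedNormalClosure r) where
  sigma :=
    { QuotientGroup.map _ _ (s.sigma : G →* G) (s.closedNormalClosure_le_comap hr) with
      continuous_toFun := (QuotientGroup.continuous_mk.comp s.sigma.continuous_toFun).quotient_lift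
        fun a b hab => (QuotientGroup.eq).2 (by
          simpa using s.closedNormalClosure_le_comap hr (QuotientGroup.leftRel_apply.1 hab)) }
  sigma_sigma := by
    rintro ⟨a⟩
    exact congrArg (QuotientGroup.mk (s := closedNormalClosure r)) (s.sigma_sigma a)

end SigmaAction

/-! ### The pro-`p`-completion of a group and the free pro-`p`-group -/

/-- The normal subgroups of `Γ` of finite index whose quotient is a `p`-group. -/
abbrev PIndexSubgroup (p : ℕ) (Γ : Type*) [Group Γ] : Type _ :=
  {N : FiniteIndexNormalSubgroup Γ // IsPGroup p (Γ ⧸ N.toSubgroup)}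

/-- The finite `p`-group `Γ ⧸ N`, with the discrete topology. -/
def PQuotient {p : ℕ} {Γ : Type*} [Group Γ] (N : PIndexSubgroup p Γ) : Type _ :=
  Γ ⧸ N.1.toSubgroup

section PQuotient

variable {p : ℕ} {Γ : Type*} [Group Γ] (N : PIndexSubgroup p Γ)

instance : Group (PQuotient N) := inferInstanceAs (Group (Γ ⧸ N.1.toSubgroup))

instance : Finite (PQuotient N) := inferInstanceAs (Finite (Γ ⧸ N.1.toSubgroup))

instance : TopologicalSpace (PQuotient N) := ⊥

instance : DiscreteTopology (PQuotient N) := ⟨rfl⟩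

/-- The projection `Γ → Γ ⧸ N`. -/
def PQuotient.mk : Γ →* PQuotient N := QuotientGroup.mk' N.1.toSubgroup

variable {N}

/-- The homomorphism `Γ ⧸ M → Γ ⧸ N` induced by `φ : Γ → Γ` with `φ M ⊆ N`. -/
def PQuotient.map {M N : PIndexSubgroup p Γ} (φ : Γ →* Γ)
    (h : M.1.toSubgroup ≤ N.1.toSubgroup.comap φ) : PQuotient M →* PQuotient N :=
  QuotientGroup.map _ _ φ h

/-- The transition map `Γ ⧸ M → Γ ⧸ N` for `M ≤ N`. -/
def PQuotient.transition {M N : PIndexSubgroup p Γ} (h : M.1.toSubgroup ≤ N.1.toSubgroup) :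
    PQuotient M →* PQuotient N :=
  PQuotient.map (MonoidHom.id Γ) h

/-- The preimage under `φ : Γ → Γ` of a normal subgroup with finite `p`-group quotient. -/
def PIndexSubgroup.comap (φ : Γ →* Γ) (N : PIndexSubgroup p Γ) : PIndexSubgroup p Γ :=
  ⟨N.1.comap φ, N.2.of_injective
    (QuotientGroup.map (N.1.comap φ).toSubgroup N.1.toSubgroup φ le_rfl) (by
      rw [injective_iff_map_eq_one]
      rintro ⟨x⟩ hx
      exact (QuotientGroup.eq_one_iff x).2 ((QuotientGroup.eq_one_iff (φ x)).1 hx))⟩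

end PQuotient

/-- The inverse limit of the finite `p`-groups `Γ ⧸ N`, as a subgroup of their product. -/
def proPCompletionSubgroup (p : ℕ) (Γ : Type*) [Group Γ] :
    Subgroup (∀ N : PIndexSubgroup p Γ, PQuotient N) where
  carrier := {x | ∀ (M N : PIndexSubgroup p Γ) (h : M.1.toSubgroup ≤ N.1.toSubgroup),
    PQuotient.transition h (x M) = x N}
  one_mem' M N h := by simp
  mul_mem' {x y} hx hy M N h := by simp [hx M N h, hy M N h]
  inv_mem' {x} hx M N h := by simp [hx M N h]

/-- The pro-`p`-completion of a group `Γ`: the inverse limit of the quotients of `Γ` that are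
finite `p`-groups. -/
abbrev ProPCompletion (p : ℕ) (Γ : Type*) [Group Γ] : Type _ := proPCompletionSubgroup p Γ

namespace ProPCompletion

variable {p : ℕ} {Γ : Type*} [Group Γ]

/-- The natural homomorphism from `Γ` to its pro-`p`-completion. -/
def of : Γ →* ProPCompletion p Γ where
  toFun g := ⟨fun N => PQuotient.mk N g, fun _ _ _ => rfl⟩
  map_one' := rfl
  map_mul' _ _ := rfl

/-- The continuous endomorphism of the pro-`p`-completion induced by an endomorphism of `Γ`. -/
def map (φ : Γ →* Γ) : ProPCompletion p Γ →ₜ* ProPCompletion p Γ where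
  toFun x := ⟨fun N => PQuotient.map (M := N.comap φ) φ le_rfl (x.1 (N.comap φ)), by
    intro M N h
    have hMN : (M.comap φ).1.toSubgroup ≤ (N.comap φ).1.toSubgroup := fun a ha => h ha
    change PQuotient.transition h (PQuotient.map (M := M.comap φ) φ le_rfl (x.1 (M.comap φ))) =
      PQuotient.map (M := N.comap φ) φ le_rfl (x.1 (N.comap φ))
    rw [← x.2 (M.comap φ) (N.comap φ) hMN]
    obtain ⟨a, ha⟩ := QuotientGroup.mk_surjective (x.1 (M.comap φ))
    rw [← ha]
    rfl⟩
  map_one' := by ext N; exact _root_.map_one (PQuotient.map (M := N.comap φ) φ le_rfl)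
  map_mul' x y := by ext N; exact _root_.map_mul (PQuotient.map (M := N.comap φ) φ le_rfl) _ _
  continuous_toFun := by
    refine Continuous.subtype_mk (continuous_pi fun N => ?_) _
    exact continuous_of_discreteTopology.comp
      ((continuous_apply (N.comap φ)).comp continuous_subtype_val)

theorem map_of (φ : Γ →* Γ) (g : Γ) : map φ (of g : ProPCompletion p Γ) = of (φ g) := rfl

theorem map_map (φ : Γ →* Γ) (hφ : ∀ g, φ (φ g) = g) (x : ProPCompletion p Γ) :
    map φ (map φ x) = x := by
  ext N
  have hN : ((N.comap φ).comap φ).1.toSubgroup ≤ N.1.toSubgroup := by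
    intro a ha
    have h : φ (φ a) ∈ N.1.toSubgroup := ha
    rwa [hφ] at h
  refine Eq.trans ?_ (x.2 ((N.comap φ).comap φ) N hN)
  obtain ⟨a, ha⟩ := QuotientGroup.mk_surjective (x.1 ((N.comap φ).comap φ))
  change PQuotient.map (M := N.comap φ) φ le_rfl
    (PQuotient.map (M := (N.comap φ).comap φ) φ le_rfl (x.1 ((N.comap φ).comap φ))) = _
  rw [← ha]
  change PQuotient.mk N (φ (φ a)) = PQuotient.mk N a
  rw [hφ]

section UniversalProperty

variable (p Γ)

theorem continuous_proj (N : PIndexSubgroup p Γ) :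
    Continuous fun x : ProPCompletion p Γ => x.1 N :=
  (continuous_apply N).comp continuous_subtype_val

theorem isClosed_subgroup :
    IsClosed (proPCompletionSubgroup p Γ : Set (∀ N : PIndexSubgroup p Γ, PQuotient N)) := by
  have : (proPCompletionSubgroup p Γ : Set (∀ N : PIndexSubgroup p Γ, PQuotient N)) =
    ⋂ (M : PIndexSubgroup p Γ) (N : PIndexSubgroup p Γ) (h : M.1.toSubgroup ≤ N.1.toSubgroup),
      {x | PQuotient.transition h (x M) = x N} := by
    ext x; simp only [Set.mem_iInter]; rfl
  rw [this]
  refine isClosed_iInter fun M => isClosed_iInter fun N => isClosed_iInter fun h => ?_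
  exact isClosed_eq (continuous_of_discreteTopology.comp (continuous_apply M)) (continuous_apply N)

instance  : CompactSpace (ProPCompletion p Γ) :=
  isCompact_iff_compactSpace.1 (isClosed_subgroup p Γ).isCompact

theorem exists_le_all [Fact p.Prime] (J : Finset (PIndexSubgroup p Γ)) :
    ∃ M : PIndexSubgroup p Γ, ∀ N ∈ J, M.1.toSubgroup ≤ N.1.toSubgroup := by
  classical
  induction J using Finset.induction_on with
  | empty =>
    refine ⟨⟨{ toSubgroup := ⊤ }, ?_⟩, by simp⟩
    intro x
    obtain ⟨a, rfl⟩ := QuotientGroup.mk_surjective x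
    exact ⟨0, (QuotientGroup.eq_one_iff _).2 (Subgroup.mem_top _)⟩
  | insert N J _ ih =>
    obtain ⟨M, hM⟩ := ih
    refine ⟨⟨M.1 ⊓ N.1, ?_⟩, ?_⟩
    · intro x
      obtain ⟨a, rfl⟩ := QuotientGroup.mk_surjective x
      obtain ⟨k, hk⟩ := M.2 (a : Γ ⧸ M.1.toSubgroup)
      obtain ⟨l, hl⟩ := N.2 (a : Γ ⧸ N.1.toSubgroup)
      refine ⟨k + l, ?_⟩
      rw [← QuotientGroup.mk_pow, QuotientGroup.eq_one_iff] at hk hl ⊢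
      refine Subgroup.mem_inf.2 ⟨?_, ?_⟩
      · rw [pow_add, pow_mul]; exact pow_mem hk _
      · rw [add_comm, pow_add, pow_mul]; exact pow_mem hl _
    · intro K hK
      rcases Finset.mem_insert.1 hK with rfl | hK
      · exact fun a ha => (Subgroup.mem_inf.1 ha).2
      · exact fun a ha => hM K hK (Subgroup.mem_inf.1 ha).1

theorem exists_fiber_subset [Fact p.Prime] (x : ProPCompletion p Γ)
    (W : Set (ProPCompletion p Γ)) (hW : IsOpen W) (hx : x ∈ W) :
    ∃ M : PIndexSubgroup p Γ, ∀ y : ProPCompletion p Γ, y.1 M = x.1 M → y ∈ W := by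
  obtain ⟨V, hV, rfl⟩ := hW
  obtain ⟨J, u, hu, hJ⟩ := isOpen_pi_iff.1 hV _ hx
  obtain ⟨M, hM⟩ := exists_le_all p Γ J
  refine ⟨M, fun y hy => hJ fun N hN => ?_⟩
  rw [← y.2 M N (hM N hN), hy, x.2 M N (hM N hN)]
  exact (hu N hN).2

theorem denseRange_of [Fact p.Prime] :
    DenseRange (of : Γ →* ProPCompletion p Γ) := by
  refine dense_iff_inter_open.2 ?_
  rintro W hW ⟨x, hx⟩
  obtain ⟨M, hM⟩ := exists_fiber_subset p Γ x W hW hx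
  obtain ⟨a, ha⟩ := QuotientGroup.mk_surjective (x.1 M)
  exact ⟨_, hM (of a) ha, a, rfl⟩

instance [Fact p.Prime] : IsProP p (ProPCompletion p Γ) where
  compactSpace := inferInstance
  totallyDisconnectedSpace := inferInstance
  isPGroup_quotient U := by
    rintro ⟨x⟩
    obtain ⟨M, hM⟩ := exists_fiber_subset p Γ 1 (U : Set _) U.isOpen' (one_mem U.toSubgroup)
    obtain ⟨k, hk⟩ := M.2 (x.1 M)
    refine ⟨k, (QuotientGroup.eq_one_iff (x ^ p ^ k)).2 (hM _ ?_)⟩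
    exact hk

/-- Universal property of the pro-`p`-completion. -/
theorem existsUnique_lift [Fact p.Prime] {H : Type*} [Group H]
    [TopologicalSpace H] [IsTopologicalGroup H] [hH : IsProP p H] (φ : Γ →* H) :
    ∃! f : ProPCompletion p Γ →ₜ* H, ∀ g, f (of g) = φ g := by
  have := hH.compactSpace
  have := hH.totallyDisconnectedSpace
  have : T2Space H := inferInstance
  let Gr : Subgroup (ProPCompletion p Γ × H) :=
    (MonoidHom.range (of.prod φ)).topologicalClosure
  have hcl : IsClosed (Gr : Set (ProPCompletion p Γ × H)) := Subgroup.isClosed_topologicalClosure _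
  have hcpt : IsCompact (Gr : Set (ProPCompletion p Γ × H)) := hcl.isCompact
  have hmem : ∀ g, (of g, φ g) ∈ Gr := fun g =>
    Subgroup.le_topologicalClosure _ ⟨g, rfl⟩
  have hsurj : ∀ x : ProPCompletion p Γ, ∃ h, (x, h) ∈ Gr := by
    have h1 : IsClosed (Prod.fst '' (Gr : Set (ProPCompletion p Γ × H))) :=
      (hcpt.image continuous_fst).isClosed
    have h2 : Dense (Prod.fst '' (Gr : Set (ProPCompletion p Γ × H))) :=
      (denseRange_of p Γ).mono (by rintro _ ⟨g, rfl⟩; exact ⟨_, hmem g, rfl⟩)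
    intro x
    have : x ∈ Prod.fst '' (Gr : Set (ProPCompletion p Γ × H)) := by
      rw [← h1.closure_eq]; exact h2 x
    obtain ⟨⟨_, h⟩, hh, rfl⟩ := this
    exact ⟨h, hh⟩
  have hinj : ∀ h : H, ((1 : ProPCompletion p Γ), h) ∈ Gr → h = 1 := by
    intro h hh
    by_contra hne
    obtain ⟨U, hU⟩ := ProfiniteGrp.exist_openNormalSubgroup_sub_open_nhds_of_one
      (G := H) (U := {h}ᶜ) isOpen_compl_singleton (by simpa using fun e => hne e.symm)
    let N : PIndexSubgroup p Γ := ⟨U.toFiniteIndexNormalSubgroup.comap φ, by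
      refine (hH.isPGroup_quotient U).of_injective (QuotientGroup.map _ U.toSubgroup φ le_rfl) ?_
      rw [injective_iff_map_eq_one]
      rintro ⟨x⟩ hx
      exact (QuotientGroup.eq_one_iff x).2 ((QuotientGroup.eq_one_iff (φ x)).1 hx)⟩
    have hopen : IsOpen {q : ProPCompletion p Γ × H | q.1.1 N = 1 ∧ h⁻¹ * q.2 ∈ U} := by
      refine IsOpen.inter ?_ ?_
      · exact (isOpen_discrete {(1 : PQuotient N)}).preimage
          ((continuous_proj p Γ N).comp continuous_fst)
      · exact U.isOpen'.preimage (continuous_const.mul continuous_snd)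
    obtain ⟨q, ⟨hq1, hq2⟩, g, rfl⟩ := mem_closure_iff.1 hh _ hopen ⟨rfl, by
      change h⁻¹ * h ∈ U.toSubgroup
      simp⟩
    have h3 : φ g ∈ U := (QuotientGroup.eq_one_iff g).1 hq1
    have h4 : h ∈ U.toSubgroup := by
      have h5 : h⁻¹ * φ g ∈ U.toSubgroup := hq2
      have h6 := mul_mem (show φ g ∈ U.toSubgroup from h3) (inv_mem h5)
      rwa [mul_inv_rev, inv_inv, mul_inv_cancel_left] at h6
    exact hU h4 rfl
  choose f hf using hsurj
  have huniq : ∀ x h, (x, h) ∈ Gr → h = f x := by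
    intro x h hh
    have := hinj (h * (f x)⁻¹) (by
      have h1 := mul_mem hh (inv_mem (hf x))
      simpa using h1)
    exact mul_inv_eq_one.1 this
  have hcont : Continuous f := by
    refine continuous_iff_isClosed.2 fun C hC => ?_
    have : f ⁻¹' C = Prod.fst '' ((Gr : Set (ProPCompletion p Γ × H)) ∩ Prod.snd ⁻¹' C) := by
      ext x
      constructor
      · intro hx; exact ⟨(x, f x), ⟨hf x, hx⟩, rfl⟩
      · rintro ⟨⟨_, h⟩, ⟨h1, h2⟩, rfl⟩
        have := huniq _ _ h1
        change f _ ∈ C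
        rw [← this]; exact h2
    rw [this]
    exact ((hcl.inter (hC.preimage continuous_snd)).isCompact.image continuous_fst).isClosed
  refine ⟨⟨⟨⟨f, (huniq _ _ (one_mem Gr)).symm⟩, fun x y =>
      (huniq _ _ (mul_mem (hf x) (hf y))).symm⟩, hcont⟩, fun g => (huniq _ _ (hmem g)).symm, ?_⟩
  intro k hk
  ext x
  have hfc : Continuous f := hcont
  have := (denseRange_of p Γ).equalizer k.continuous_toFun hfc
      (funext fun g => (hk g).trans (huniq _ _ (hmem g)))
  exact congrFun this x

end UniversalProperty

end ProPCompletion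

/-- The free pro-`p`-group `F_n` on `n` generators. -/
abbrev FreeProP (p n : ℕ) : Type := ProPCompletion p (FreeGroup (Fin n))

namespace FreeProP

/-- The free generators `x_1, …, x_n` of `F_n`. -/
def gen (p : ℕ) {n : ℕ} (i : Fin n) : FreeProP p n := ProPCompletion.of (FreeGroup.of i)

/-- The endomorphism of the abstract free group that inverts every free generator. -/
def invertGens (n : ℕ) : FreeGroup (Fin n) →* FreeGroup (Fin n) :=
  FreeGroup.lift fun i => (FreeGroup.of i)⁻¹

theorem invertGens_invertGens (n : ℕ) (g : FreeGroup (Fin n)) :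
    invertGens n (invertGens n g) = g := by
  have h : (invertGens n).comp (invertGens n) = MonoidHom.id _ := by
    ext i
    simp [invertGens]
  exact DFunLike.congr_fun h g

/-- The action of `σ` on `F_n` for which the free generators are odd. -/
def sigmaAction (p n : ℕ) : SigmaAction (FreeProP p n) where
  sigma := ProPCompletion.map (invertGens n)
  sigma_sigma := ProPCompletion.map_map _ (invertGens_invertGens n)

/-- `F_n` is the free pro-`p`-group on `x_1, …, x_n`. -/
theorem existsUnique_hom (p n : ℕ) [Fact p.Prime] {H : Type*} [Group H] [TopologicalSpace H]
    [IsTopologicalGroup H] [IsProP p H] (h : Fin n → H) :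
    ∃! f : FreeProP p n →ₜ* H, ∀ i, f (gen p i) = h i := by
  obtain ⟨f, hf, huniq⟩ := ProPCompletion.existsUnique_lift p _ (FreeGroup.lift h)
  refine ⟨f, fun i => (hf _).trans FreeGroup.lift_apply_of, fun k hk => huniq k fun g => ?_⟩
  have hg : (k : FreeProP p n →* H).comp ProPCompletion.of = FreeGroup.lift h := by
    ext i
    exact (hk i).trans FreeGroup.lift_apply_of.symm
  exact DFunLike.congr_fun hg g

theorem gen_mem_oddPart (p : ℕ) {n : ℕ} (i : Fin n) : gen p i ∈ (sigmaAction p n).oddPart := by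
  change ProPCompletion.of (invertGens n (FreeGroup.of i)) = (ProPCompletion.of (FreeGroup.of i))⁻¹
  simp [invertGens]

end FreeProP

/-! ### Cohomology with coefficients in `𝔽_p` -/

section Cohomology

universe u

variable (p : ℕ) (G : Type u) [Group G] [TopologicalSpace G]

instance : ContinuousSMul (ZMod p) (ULift.{u} (ZMod p)) := ⟨continuous_of_discreteTopology⟩

/-- `𝔽_p` with the trivial action of `G` (lifted to the universe of `G`). -/
noncomputable abbrev trivialFp : TopRep.{u} (ZMod p) G :=
  TopRep.of (ContRepresentation.trivial (ZMod p) G (ULift.{u} (ZMod p)))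

/-- The continuous cohomology `H^i(G, 𝔽_p)` with trivial action on the coefficients. -/
noncomputable abbrev HFp [IsTopologicalGroup G] (i : ℕ) : TopModuleCat.{u} (ZMod p) :=
  continuousCohomology i (trivialFp p G)

/-- The number `d_G = dim H¹(G, 𝔽_p)`. -/
noncomputable def dGen [IsTopologicalGroup G] : ℕ := Module.finrank (ZMod p) (HFp p G 1)

variable {G}

/-- The action of `σ` on `H^i(G, 𝔽_p)`: the map induced by `σ : G → G` and the identity on the
coefficients. -/
noncomputable def sigmaOnHFp [IsTopologicalGroup G] (s : SigmaAction G) (i : ℕ) :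
    HFp p G i ⟶ HFp p G i :=
  ContinuousCohomology.map (X := trivialFp p G) (Y := trivialFp p G) s.sigma
    (TopRep.ofHom ⟨ContinuousLinearMap.id (ZMod p) (ULift.{u} (ZMod p)), fun _ => rfl⟩) i

end Cohomology

/-- `G` is `σ`-isomorphic to `F_n / N_r` for some tuple `r` of `n` odd elements of `F_n`, where
`N_r` is the closed normal subgroup generated by all conjugates of the entries of `r`. -/
def HasOddPresentation (p : ℕ) {G : Type*} [Group G] [TopologicalSpace G] (s : SigmaAction G)
    (n : ℕ) : Prop :=
  ∃ (r : Fin n → FreeProP p n) (hr : ∀ i, r i ∈ (FreeProP.sigmaAction p n).oddPart),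
    s.Isomorphic ((FreeProP.sigmaAction p n).quotient r hr)

/-!
Throughout, `f : F → G` is a continuous surjection of pro-`p`-groups with kernel `R`. Inflation,
restriction and transgression form the exact sequence
`0 → H¹(G) → H¹(F) → H¹(R)^F → H²(G) → H²(F)` with coefficients in `𝔽_p`; all of its maps commute
with `σ` when `f` does, and the last term vanishes when `F` is free.

If `G = F_n / N_r` with odd `r_i`, then evaluation at the `r_i` embeds `H¹(N_r)^F` into `𝔽_p^n`, and
`σ` acts on it by `-1` because the `r_i` are odd. It also acts by `-1` on `H¹(F_n)`, which has
dimension `n`. The sequence gives `dim H²(G) ≤ n - (n - dim H¹(G))` and the action of `σ` on both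
cohomology groups of `G` (`cohomology_of_hasOddPresentation`). No minimality of the presentation is
needed.

Conversely, let `d = dim H¹(G)`. If `σ` sends a homomorphism `χ` to `-χ`, then
`χ (x (σ x)⁻¹) = 2 χ x`, so that `χ = 0` as soon as `χ` vanishes at all odd elements, `p` being odd.
Hence there are `d` odd elements of `G` with no nonzero common zero in `H¹(G)`, and they define a
`σ`-equivariant surjection `F_d → G` inducing an isomorphism on `H¹`
(`exists_surjective_of_sigma_eq_neg`). Transgression then embeds `H¹(R)^F` into `H²(G)`, so it has
dimension at most `d` and `σ` acts on it by `-1`, and `d` odd elements of `R` detect it in the same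
way. They generate `R` as a closed normal subgroup by `le_of_forall_invariantHom`
(`hasOddPresentation_of_cohomology`).

Cohomology classes are handled through inhomogeneous cochains: `classOne` and `classTwo` identify
`H¹` with continuous homomorphisms and `H²` with continuous `2`-cocycles modulo coboundaries.
The vanishing of `H²(F_n)` comes from splitting the extension attached to a cocycle
(`FreeProP.exists_coboundary_eq`). The transgression (`exists_transgression`) extends an invariant
homomorphism `φ` on `R` to a function `b` on `F` with `b (x r) = b x + φ r`, whose coboundary
descends to `G`.
-/

/-! ### Homology classes in complexes of topological modules -/

section TopModuleCatHomology

open CategoryTheory Limits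

universe v u w

variable {k : Type u} [Ring k] [TopologicalSpace k] {ι : Type w} {c : ComplexShape ι}

/-- The linear map sending a cycle of a complex of topological modules, that is an element of the
kernel of the differential, to its homology class. -/
noncomputable def homologyClass (K : HomologicalComplex (TopModuleCat.{v} k) c) {i j : ι}
    (hj : c.next i = j) : (K.d i j).hom.ker →ₗ[k] K.homology i :=
  (K.liftCycles (TopModuleCat.kerι (K.d i j)) j hj (TopModuleCat.kerι_comp _) ≫
    K.homologyπ i).hom.toLinearMap

theorem liftCycles_kerι_bijective (K : HomologicalComplex (TopModuleCat.{v} k) c) {i j : ι}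
    (hj : c.next i = j) :
    Function.Bijective
      (K.liftCycles (TopModuleCat.kerι (K.d i j)) j hj (TopModuleCat.kerι_comp _)).hom := by
  let e := IsLimit.conePointUniqueUpToIso (TopModuleCat.isLimitKer (K.d i j))
    (K.cyclesIsKernel i j hj)
  have he : K.liftCycles (TopModuleCat.kerι (K.d i j)) j hj (TopModuleCat.kerι_comp _) = e.hom := by
    rw [← cancel_mono (K.iCycles i), K.liftCycles_i]
    exact (IsLimit.conePointUniqueUpToIso_hom_comp (TopModuleCat.isLimitKer (K.d i j))
      (K.cyclesIsKernel i j hj) WalkingParallelPair.zero).symm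
  rw [he]
  exact (e.toContinuousLinearEquiv).bijective

theorem homologyClass_surjective (K : HomologicalComplex (TopModuleCat.{v} k) c) {i j : ι}
    (hj : c.next i = j) : Function.Surjective (homologyClass K hj) := by
  let e := IsColimit.coconePointUniqueUpToIso (K.homologyIsCokernel (c.prev i) i rfl)
    (TopModuleCat.isColimitCoker (K.toCycles (c.prev i) i))
  have he : K.homologyπ i = TopModuleCat.cokerπ (K.toCycles (c.prev i) i) ≫ e.inv :=
    (IsColimit.comp_coconePointUniqueUpToIso_inv (K.homologyIsCokernel (c.prev i) i rfl)
      (TopModuleCat.isColimitCoker (K.toCycles (c.prev i) i)) WalkingParallelPair.one).symm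
  have hπ : Function.Surjective (K.homologyπ i).hom := by
    rw [he]
    exact (e.toContinuousLinearEquiv).symm.surjective.comp (TopModuleCat.cokerπ_surjective _)
  exact hπ.comp (liftCycles_kerι_bijective K hj).2

theorem homologyClass_eq_zero_iff (K : HomologicalComplex (TopModuleCat.{v} k) c) {h i j : ι}
    (hh : c.prev i = h) (hj : c.next i = j) (z : (K.d i j).hom.ker) :
    homologyClass K hj z = 0 ↔ ∃ y, (K.d h i).hom y = z.1 := by
  subst hh
  let e := IsColimit.coconePointUniqueUpToIso (K.homologyIsCokernel (c.prev i) i rfl)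
    (TopModuleCat.isColimitCoker (K.toCycles (c.prev i) i))
  have he : K.homologyπ i ≫ e.hom = TopModuleCat.cokerπ (K.toCycles (c.prev i) i) :=
    IsColimit.comp_coconePointUniqueUpToIso_hom (K.homologyIsCokernel (c.prev i) i rfl)
      (TopModuleCat.isColimitCoker (K.toCycles (c.prev i) i)) WalkingParallelPair.one
  have hi : Function.Injective (K.iCycles i).hom := by
    intro a b hab
    obtain ⟨a, rfl⟩ := (liftCycles_kerι_bijective K hj).2 a
    obtain ⟨b, rfl⟩ := (liftCycles_kerι_bijective K hj).2 b
    have h2 := K.liftCycles_i (TopModuleCat.kerι (K.d i j)) j hj (TopModuleCat.kerι_comp _)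
    have h3 : ∀ x, (K.iCycles i).hom ((K.liftCycles (TopModuleCat.kerι (K.d i j)) j hj
        (TopModuleCat.kerι_comp _)).hom x) = x.1 := fun x => by
      exact ConcreteCategory.congr_hom h2 x
    rw [h3, h3] at hab
    rw [Subtype.ext hab]
  set l := (K.liftCycles (TopModuleCat.kerι (K.d i j)) j hj (TopModuleCat.kerι_comp _)).hom z
    with hl
  have hlz : (K.iCycles i).hom l = z.1 :=
    ConcreteCategory.congr_hom (K.liftCycles_i (TopModuleCat.kerι (K.d i j)) j hj
      (TopModuleCat.kerι_comp _)) z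
  have h1 : homologyClass K hj z = (K.homologyπ i).hom l := rfl
  have h4 : (K.homologyπ i).hom l = 0 ↔ l ∈ (K.toCycles (c.prev i) i).hom.range := by
    rw [← (Submodule.Quotient.mk_eq_zero (K.toCycles (c.prev i) i).hom.range)]
    have h5 : (e.hom.hom ((K.homologyπ i).hom l)) =
      Submodule.Quotient.mk (p := (K.toCycles (c.prev i) i).hom.range) l :=
      ConcreteCategory.congr_hom he l
    rw [← h5]
    exact (map_eq_zero_iff e.hom.hom (e.toContinuousLinearEquiv).injective).symm
  rw [h1, h4]
  have h6 : ∀ y, (K.iCycles i).hom ((K.toCycles (c.prev i) i).hom y) =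
      (K.d (c.prev i) i).hom y := fun y =>
    ConcreteCategory.congr_hom (K.toCycles_i (c.prev i) i) y
  constructor
  · rintro ⟨y, hy⟩
    exact ⟨y, by rw [← h6, ← hlz]; exact congrArg _ hy⟩
  · rintro ⟨y, hy⟩
    exact ⟨y, hi (by rw [hlz, ← hy]; exact h6 y)⟩

theorem homologyMap_homologyClass {K L : HomologicalComplex (TopModuleCat.{v} k) c} (φ : K ⟶ L)
    {i j : ι} (hj : c.next i = j) (z : (K.d i j).hom.ker) (w : (L.d i j).hom.ker)
    (hw : w.1 = (φ.f i).hom z.1) :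
    (HomologicalComplex.homologyMap φ i).hom (homologyClass K hj z) = homologyClass L hj w := by
  have h1 : (HomologicalComplex.homologyMap φ i).hom (homologyClass K hj z) =
      (L.homologyπ i).hom ((HomologicalComplex.cyclesMap φ i).hom
        ((K.liftCycles (TopModuleCat.kerι (K.d i j)) j hj (TopModuleCat.kerι_comp _)).hom z)) :=
    ConcreteCategory.congr_hom (HomologicalComplex.homologyπ_naturality φ i) _
  obtain ⟨w', hw'⟩ := (liftCycles_kerι_bijective L hj).2
    ((HomologicalComplex.cyclesMap φ i).hom
        ((K.liftCycles (TopModuleCat.kerι (K.d i j)) j hj (TopModuleCat.kerι_comp _)).hom z))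
  have h2 : w' = w := by
    apply Subtype.ext
    have h3 := ConcreteCategory.congr_hom (L.liftCycles_i (TopModuleCat.kerι (L.d i j)) j hj
      (TopModuleCat.kerι_comp _)) w'
    have h4 := ConcreteCategory.congr_hom (HomologicalComplex.cyclesMap_i φ i)
      ((K.liftCycles (TopModuleCat.kerι (K.d i j)) j hj (TopModuleCat.kerι_comp _)).hom z)
    have h5 := ConcreteCategory.congr_hom (K.liftCycles_i (TopModuleCat.kerι (K.d i j)) j hj
      (TopModuleCat.kerι_comp _)) z
    refine Eq.trans h3.symm (Eq.trans (congrArg (L.iCycles i).hom hw') ?_)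
    refine Eq.trans h4 ?_
    rw [hw]
    exact congrArg (φ.f i).hom h5
  rw [h1, ← hw', h2]
  rfl

end TopModuleCatHomology

/-! ### Inhomogeneous cochains in degrees one and two -/

section InhomogeneousCochains

open CategoryTheory TopRep

universe u

variable (p : ℕ) (G : Type u) [Group G] [TopologicalSpace G]

/-- The space `Hom(G, 𝔽_p)` of continuous homomorphisms, as a space of continuous functions. -/
def ctsHom : Submodule (ZMod p) C(G, ZMod p) where
  carrier := {χ | ∀ x y, χ (x * y) = χ x + χ y}
  zero_mem' x y := by simp
  add_mem' {χ ψ} hχ hψ x y := by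
    simp only [ContinuousMap.add_apply, hχ x y, hψ x y]; abel
  smul_mem' a χ hχ x y := by
    simp only [ContinuousMap.smul_apply, hχ x y, smul_add]

/-- The space of continuous inhomogeneous `2`-cocycles of `G` with values in `𝔽_p`. -/
def twoCocycle : Submodule (ZMod p) C(G × G, ZMod p) where
  carrier := {c | ∀ x y z, c (y, z) + c (x, y * z) = c (x * y, z) + c (x, y)}
  zero_mem' x y z := by simp
  add_mem' {c d} hc hd x y z := by
    simp only [ContinuousMap.add_apply]
    linear_combination hc x y z + hd x y z
  smul_mem' a c hc x y z := by
    simp only [ContinuousMap.smul_apply, ← smul_add, hc x y z]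

variable {G}

variable {p} in
theorem map_one_of_mem_ctsHom {χ : C(G, ZMod p)} (h : χ ∈ ctsHom p G) : χ 1 = 0 := by
  simpa using h 1 1

variable {p} in
theorem map_inv_of_mem_ctsHom {χ : C(G, ZMod p)} (h : χ ∈ ctsHom p G) (x : G) :
    χ x⁻¹ = -χ x := by
  have h1 := h x⁻¹ x
  rw [inv_mul_cancel, map_one_of_mem_ctsHom h] at h1
  exact eq_neg_of_add_eq_zero_left h1.symm

variable [IsTopologicalGroup G]

/-- The homogeneous `1`-cochain `(x, y) ↦ a (x⁻¹ y)` attached to a function `a` on `G`. -/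
noncomputable def homogeneous₁ :
    C(G, ZMod p) →ₗ[ZMod p] (homogeneousCochains (trivialFp p G)).X 1 where
  toFun a := ⟨ContinuousMap.curry
    ⟨fun q : G × G => ULift.up (a (q.1⁻¹ * q.2)), by fun_prop⟩, fun g => by
      refine ContinuousMap.ext fun x => ContinuousMap.ext fun y => ?_
      change ULift.up (a ((g⁻¹ * x)⁻¹ * (g⁻¹ * y))) = ULift.up (a (x⁻¹ * y))
      congr 2; group⟩
  map_add' _ _ := rfl
  map_smul' _ _ := rfl

/-- The homogeneous `2`-cochain `(x, y, z) ↦ c (x⁻¹ y, y⁻¹ z)` attached to a function `c` on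
`G × G`. -/
noncomputable def homogeneous₂ :
    C(G × G, ZMod p) →ₗ[ZMod p] (homogeneousCochains (trivialFp p G)).X 2 where
  toFun c := ⟨ContinuousMap.curry (ContinuousMap.curry
    ⟨fun q : (G × G) × G => ULift.up (c (q.1.1⁻¹ * q.1.2, q.1.2⁻¹ * q.2)), by fun_prop⟩),
    fun g => by
      refine ContinuousMap.ext fun x => ContinuousMap.ext fun y => ContinuousMap.ext fun z => ?_
      change ULift.up (c ((g⁻¹ * x)⁻¹ * (g⁻¹ * y), (g⁻¹ * y)⁻¹ * (g⁻¹ * z))) =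
        ULift.up (c (x⁻¹ * y, y⁻¹ * z))
      congr 3 <;> group⟩
  map_add' _ _ := rfl
  map_smul' _ _ := rfl

theorem homogeneous₁_injective : Function.Injective (homogeneous₁ p (G := G)) := by
  intro a b h
  ext y
  have h1 : ULift.up (a (1⁻¹ * y)) = ULift.up (b (1⁻¹ * y)) :=
    DFunLike.congr_fun (DFunLike.congr_fun (congrArg Subtype.val h) (1 : G)) y
  simpa using h1

theorem homogeneous₁_surjective : Function.Surjective (homogeneous₁ p (G := G)) := by
  rintro ⟨f, hf⟩
  refine ⟨⟨fun y => ULift.down (f 1 y), by fun_prop⟩, Subtype.ext ?_⟩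
  refine ContinuousMap.ext fun x => ContinuousMap.ext fun y => ?_
  change ULift.up (ULift.down (f 1 (x⁻¹ * y))) = f x y
  have h1 : f (x⁻¹ * x) (x⁻¹ * y) = f x y :=
    DFunLike.congr_fun (DFunLike.congr_fun (hf x) x) y
  rw [inv_mul_cancel] at h1
  exact h1

theorem homogeneous₂_injective : Function.Injective (homogeneous₂ p (G := G)) := by
  intro a b h
  ext ⟨y, z⟩
  have h1 : ULift.up (a (1⁻¹ * y, y⁻¹ * (y * z))) = ULift.up (b (1⁻¹ * y, y⁻¹ * (y * z))) :=
    DFunLike.congr_fun (DFunLike.congr_fun (DFunLike.congr_fun (congrArg Subtype.val h) (1 : G)) y)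
      (y * z)
  simpa using h1

theorem homogeneous₂_surjective [LocallyCompactSpace G] :
    Function.Surjective (homogeneous₂ p (G := G)) := by
  rintro ⟨f, hf⟩
  have hf1 : Continuous (fun q : G × G => f 1 q.1 q.2) :=
    ContinuousMap.continuous_uncurry_of_continuous (f 1)
  have hf2 : Continuous (fun q : G × G => ULift.down (f 1 q.1 (q.1 * q.2))) :=
    continuous_uliftDown.comp (hf1.comp (continuous_fst.prodMk continuous_mul))
  refine ⟨⟨_, hf2⟩, Subtype.ext ?_⟩
  refine ContinuousMap.ext fun x => ContinuousMap.ext fun y => ContinuousMap.ext fun z => ?_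
  change ULift.up (ULift.down (f 1 (x⁻¹ * y) (x⁻¹ * y * (y⁻¹ * z)))) = f x y z
  have h1 : f (x⁻¹ * x) (x⁻¹ * y) (x⁻¹ * z) = f x y z :=
    DFunLike.congr_fun (DFunLike.congr_fun (DFunLike.congr_fun (hf x) x) y) z
  rw [inv_mul_cancel] at h1
  rw [← h1]
  exact congrArg (f 1 (x⁻¹ * y)) (by group)

/-- The coboundary `(x, y) ↦ a x + a y - a (x y)` of a continuous function `a` on `G`. -/
def coboundary (a : C(G, ZMod p)) : C(G × G, ZMod p) :=
  ⟨fun q => a q.1 + a q.2 - a (q.1 * q.2), by fun_prop⟩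

theorem d_homogeneous₀ (f : (homogeneousCochains (trivialFp p G)).X 0) :
    ((homogeneousCochains (trivialFp p G)).d 0 1).hom f = 0 := by
  refine Subtype.ext ?_
  rw [homogeneousCochains.d_apply]
  refine ContinuousMap.ext fun x => ContinuousMap.ext fun y => ?_
  change f.1 y - f.1 x = 0
  have h1 : f.1 (x⁻¹ * x) = f.1 x := DFunLike.congr_fun (f.2 x) x
  have h2 : f.1 (y⁻¹ * y) = f.1 y := DFunLike.congr_fun (f.2 y) y
  rw [inv_mul_cancel] at h1 h2
  rw [← h1, ← h2, sub_self]

theorem d_homogeneous₁ (a : C(G, ZMod p)) :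
    ((homogeneousCochains (trivialFp p G)).d 1 2).hom (homogeneous₁ p a) =
      homogeneous₂ p (coboundary p a) := by
  refine Subtype.ext ?_
  rw [homogeneousCochains.d_apply]
  refine ContinuousMap.ext fun x => ContinuousMap.ext fun y => ContinuousMap.ext fun z => ?_
  change ULift.up (a (y⁻¹ * z)) - (ULift.up (a (x⁻¹ * z)) - ULift.up (a (x⁻¹ * y))) =
    ULift.up (a (x⁻¹ * y) + a (y⁻¹ * z) - a (x⁻¹ * y * (y⁻¹ * z)))
  have : x⁻¹ * y * (y⁻¹ * z) = x⁻¹ * z := by group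
  rw [this]
  apply ULift.ext
  change a (y⁻¹ * z) - (a (x⁻¹ * z) - a (x⁻¹ * y)) = _
  ring

theorem d_homogeneous₂_eq_zero_iff (c : C(G × G, ZMod p)) :
    ((homogeneousCochains (trivialFp p G)).d 2 3).hom (homogeneous₂ p c) = 0 ↔
      c ∈ twoCocycle p G := by
  have key : ∀ x y z w : G,
      (((homogeneousCochains (trivialFp p G)).d 2 3).hom (homogeneous₂ p c)).1 x y z w =
        ULift.up (c (y⁻¹ * z, z⁻¹ * w) - (c (x⁻¹ * z, z⁻¹ * w) -
          (c (x⁻¹ * y, y⁻¹ * w) - c (x⁻¹ * y, y⁻¹ * z)))) := by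
    intro x y z w
    rw [homogeneousCochains.d_apply]
    rfl
  constructor
  · intro h x y z
    have h1 := key 1 x (x * y) (x * y * z)
    rw [h] at h1
    have h2 := congrArg ULift.down h1
    change 0 = _ at h2
    simp only [inv_one, one_mul, mul_assoc, inv_mul_cancel_left, mul_inv_rev] at h2
    linear_combination -h2
  · intro h
    refine Subtype.ext (ContinuousMap.ext fun x => ContinuousMap.ext fun y =>
      ContinuousMap.ext fun z => ContinuousMap.ext fun w => ?_)
    rw [key]
    have h1 := h (x⁻¹ * y) (y⁻¹ * z) (z⁻¹ * w)
    have e1 : y⁻¹ * z * (z⁻¹ * w) = y⁻¹ * w := by group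
    have e2 : x⁻¹ * y * (y⁻¹ * z) = x⁻¹ * z := by group
    rw [e1, e2] at h1
    apply ULift.ext
    change _ = (0 : ZMod p)
    linear_combination h1

/-- The class in `H¹(G, 𝔽_p)` of a continuous homomorphism. -/
noncomputable def classOne : ctsHom p G →ₗ[ZMod p] HFp p G 1 :=
  (homologyClass (homogeneousCochains (trivialFp p G)) (i := 1) (j := 2) (by simp)).comp
    (((homogeneous₁ p).comp (ctsHom p G).subtype).codRestrict
      ((homogeneousCochains (trivialFp p G)).d 1 2).hom.ker fun χ => by
        change ((homogeneousCochains (trivialFp p G)).d 1 2).hom (homogeneous₁ p χ.1) = 0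
        rw [d_homogeneous₁]
        have : coboundary p χ.1 = 0 := by
          ext q
          change χ.1 q.1 + χ.1 q.2 - χ.1 (q.1 * q.2) = 0
          rw [χ.2 q.1 q.2, sub_self]
        rw [this, map_zero])

/-- The class in `H²(G, 𝔽_p)` of a continuous inhomogeneous `2`-cocycle. -/
noncomputable def classTwo : twoCocycle p G →ₗ[ZMod p] HFp p G 2 :=
  (homologyClass (homogeneousCochains (trivialFp p G)) (i := 2) (j := 3) (by simp)).comp
    (((homogeneous₂ p).comp (twoCocycle p G).subtype).codRestrict
      ((homogeneousCochains (trivialFp p G)).d 2 3).hom.ker fun c =>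
        (d_homogeneous₂_eq_zero_iff p c.1).2 c.2)

theorem classOne_bijective [LocallyCompactSpace G] : Function.Bijective (classOne p (G := G)) := by
  constructor
  · rw [injective_iff_map_eq_zero]
    intro χ hχ
    obtain ⟨y, hy⟩ := (homologyClass_eq_zero_iff _ (h := 0) (by simp) _ _).1 hχ
    rw [d_homogeneous₀] at hy
    refine Subtype.ext (homogeneous₁_injective p ?_)
    rw [ZeroMemClass.coe_zero, map_zero]
    exact hy.symm
  · intro t
    obtain ⟨⟨z, hz⟩, rfl⟩ := homologyClass_surjective
      (homogeneousCochains (trivialFp p G)) (i := 1) (j := 2) (by simp) t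
    obtain ⟨a, rfl⟩ := homogeneous₁_surjective p z
    have ha : a ∈ ctsHom p G := by
      have h1 : ((homogeneousCochains (trivialFp p G)).d 1 2).hom (homogeneous₁ p a) = 0 := hz
      rw [d_homogeneous₁] at h1
      have h2 := homogeneous₂_injective p (h1.trans (map_zero _).symm)
      intro x y
      have h3 : a x + a y - a (x * y) = 0 := DFunLike.congr_fun h2 (x, y)
      exact (sub_eq_zero.1 h3).symm
    exact ⟨⟨a, ha⟩, rfl⟩

theorem classTwo_surjective [LocallyCompactSpace G] :
    Function.Surjective (classTwo p (G := G)) := by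
  intro t
  obtain ⟨⟨z, hz⟩, rfl⟩ := homologyClass_surjective
    (homogeneousCochains (trivialFp p G)) (i := 2) (j := 3) (by simp) t
  obtain ⟨c, rfl⟩ := homogeneous₂_surjective p z
  exact ⟨⟨c, (d_homogeneous₂_eq_zero_iff p c).1 hz⟩, rfl⟩

theorem classTwo_eq_zero_iff (c : twoCocycle p G) :
    classTwo p c = 0 ↔ ∃ a, coboundary p a = c.1 := by
  have h := homologyClass_eq_zero_iff (homogeneousCochains (trivialFp p G)) (h := 1) (i := 2)
    (j := 3) (by simp) (by simp) ⟨homogeneous₂ p c.1, (d_homogeneous₂_eq_zero_iff p c.1).2 c.2⟩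
  refine h.trans ⟨?_, ?_⟩
  · rintro ⟨y, hy⟩
    obtain ⟨a, rfl⟩ := homogeneous₁_surjective p y
    exact ⟨a, homogeneous₂_injective p ((d_homogeneous₁ p a).symm.trans hy)⟩
  · rintro ⟨a, ha⟩
    exact ⟨homogeneous₁ p a, (d_homogeneous₁ p a).trans (congrArg _ ha)⟩

variable {p}

theorem sigmaOnHFp_classOne (s : SigmaAction G) (χ ψ : ctsHom p G)
    (h : ∀ x, ψ.1 x = χ.1 (s.sigma x)) :
    (sigmaOnHFp p s 1).hom (classOne p χ) = classOne p ψ := by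
  refine homologyMap_homologyClass _ _ _ _ (Subtype.ext ?_)
  refine ContinuousMap.ext fun x => ContinuousMap.ext fun y => ?_
  change ULift.up (ψ.1 (x⁻¹ * y)) = ULift.up (χ.1 ((s.sigma x)⁻¹ * s.sigma y))
  rw [h, map_mul, map_inv]

theorem sigmaOnHFp_classTwo (s : SigmaAction G) (c d : twoCocycle p G)
    (h : ∀ x y, d.1 (x, y) = c.1 (s.sigma x, s.sigma y)) :
    (sigmaOnHFp p s 2).hom (classTwo p c) = classTwo p d := by
  refine homologyMap_homologyClass _ _ _ _ (Subtype.ext ?_)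
  refine ContinuousMap.ext fun x => ContinuousMap.ext fun y => ContinuousMap.ext fun z => ?_
  change ULift.up (d.1 (x⁻¹ * y, y⁻¹ * z)) =
    ULift.up (c.1 ((s.sigma x)⁻¹ * s.sigma y, (s.sigma y)⁻¹ * s.sigma z))
  rw [h]
  simp only [map_mul, map_inv]

end InhomogeneousCochains

/-! ### Invariant homomorphisms on a normal subgroup -/

section InvariantHom

variable (p : ℕ) {F : Type*} [Group F] [TopologicalSpace F]

/-- The space `H¹(R, 𝔽_p)^F` of continuous homomorphisms from a normal subgroup `R` of `F` to `𝔽_p`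
that are invariant under conjugation by `F`. -/
def invariantHom (R : Subgroup F) [R.Normal] : Submodule (ZMod p) C(R, ZMod p) where
  carrier := {φ | (∀ r s, φ (r * s) = φ r + φ s) ∧ ∀ (x : F) r, φ (MulAut.conjNormal x r) = φ r}
  zero_mem' := by simp
  add_mem' {φ ψ} hφ hψ := by
    refine ⟨fun r s => ?_, fun x r => ?_⟩
    · simp only [ContinuousMap.add_apply, hφ.1 r s, hψ.1 r s]; abel
    · simp only [ContinuousMap.add_apply, hφ.2 x r, hψ.2 x r]
  smul_mem' a φ hφ := by
    refine ⟨fun r s => ?_, fun x r => ?_⟩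
    · simp only [ContinuousMap.smul_apply, hφ.1 r s, smul_add]
    · simp only [ContinuousMap.smul_apply, hφ.2 x r]

variable {p}

theorem map_one_of_mem_invariantHom {R : Subgroup F} [R.Normal] {φ : C(R, ZMod p)}
    (hφ : φ ∈ invariantHom p R) : φ 1 = 0 := by
  simpa using hφ.1 1 1

theorem map_inv_of_mem_invariantHom {R : Subgroup F} [R.Normal] {φ : C(R, ZMod p)}
    (hφ : φ ∈ invariantHom p R) (r : R) : φ r⁻¹ = -φ r := by
  have h1 := hφ.1 r⁻¹ r
  rw [inv_mul_cancel, map_one_of_mem_invariantHom hφ] at h1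
  exact eq_neg_of_add_eq_zero_left h1.symm

end InvariantHom

/-! ### Homomorphisms to `𝔽_p` separate subgroups of pro-`p`-groups -/

section Separation

variable {p : ℕ} [Fact p.Prime]

theorem IsPGroup.exists_hom_ne_one {P : Type*} [Group P] [Finite P] (hP : IsPGroup p P)
    (H : Subgroup P) (hH : H ≠ ⊤) :
    ∃ φ : P →* Multiplicative (ZMod p), φ ≠ 1 ∧ ∀ h ∈ H, φ h = 1 := by
  obtain ⟨n, hn⟩ := hP.exists_card_eq
  obtain ⟨m, hm⟩ := (hP.to_subgroup H).exists_card_eq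
  have hp : p.Prime := Fact.out
  have hmn : m < n := by
    have h1 : Nat.card H < Nat.card P := by
      refine lt_of_le_of_ne (Subgroup.card_le_card_group H) fun h => hH ?_
      exact Subgroup.eq_top_of_card_eq H h
    rwa [hm, hn, Nat.pow_lt_pow_iff_right hp.one_lt] at h1
  obtain ⟨K, hK, hHK⟩ := Sylow.exists_subgroup_card_pow_prime_le (m := n - 1) p
    (by rw [hn]; exact pow_dvd_pow p (Nat.sub_le n 1)) H hm (by omega)
  have hidx : K.index = p := by
    have h1 := K.card_mul_index
    obtain ⟨l, rfl⟩ : ∃ l, n = l + 1 := ⟨n - 1, by omega⟩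
    rw [hK, hn, Nat.add_sub_cancel, pow_succ] at h1
    exact Nat.eq_of_mul_eq_mul_left (pow_pos hp.pos l) h1
  have hnorm : K.Normal := by
    refine Subgroup.normal_of_index_eq_minFac_card ?_
    rw [hidx, hn, Nat.pow_minFac (by omega), hp.minFac_eq]
  let e : P ⧸ K ≃* Multiplicative (ZMod p) := mulEquivOfPrimeCardEq (p := p)
    (by rw [← hidx]; rfl) (by simp)
  refine ⟨e.toMonoidHom.comp (QuotientGroup.mk' K), fun h => ?_, fun h hh => ?_⟩
  · have hKtop : K = ⊤ := by
      refine (Subgroup.eq_top_iff' K).2 fun x => ?_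
      have h1 : e (QuotientGroup.mk' K x) = 1 := DFunLike.congr_fun h x
      exact (QuotientGroup.eq_one_iff x).1 ((map_eq_one_iff e e.injective).1 h1)
    rw [hKtop, Subgroup.index_top] at hidx
    exact hp.one_lt.ne hidx
  · change e (QuotientGroup.mk' K h) = 1
    rw [(map_eq_one_iff e e.injective)]
    exact (QuotientGroup.eq_one_iff h).2 (hHK hh)

/-- The finite `p`-group `P` acts by conjugation on the nontrivial finite `p`-group of
homomorphisms `R/N → 𝔽_p`, so it fixes a nontrivial one. -/
theorem IsPGroup.exists_invariant_hom_ne_one {P : Type*} [Group P] [Finite P] (hP : IsPGroup p P)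
    (R N : Subgroup P) [R.Normal] [N.Normal] (hN : ¬ R ≤ N) :
    ∃ φ : R →* Multiplicative (ZMod p), φ ≠ 1 ∧ (∀ r : R, (r : P) ∈ N → φ r = 1) ∧
      ∀ (g : P) (r : R), φ (MulAut.conjNormal g r) = φ r := by
  let A : Subgroup (R →* Multiplicative (ZMod p)) :=
    { carrier := {φ | ∀ r : R, (r : P) ∈ N → φ r = 1}
      one_mem' := fun _ _ => rfl
      mul_mem' := fun {a b} ha hb r hr => by simp [ha r hr, hb r hr]
      inv_mem' := fun {a} ha r hr => by simp [ha r hr] }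
  have : Finite (R →* Multiplicative (ZMod p)) := DFunLike.finite _
  let act : MulAction P A :=
    { smul := fun g φ => ⟨φ.1.comp (MulAut.conjNormal g⁻¹ : MulAut R).toMonoidHom, fun r hr =>
        φ.2 _ (by
          change ((MulAut.conjNormal g⁻¹ r : R) : P) ∈ N
          rw [MulAut.conjNormal_apply]
          exact Subgroup.Normal.conj_mem inferInstance _ hr _)⟩
      one_smul := fun φ => by
        refine Subtype.ext (MonoidHom.ext fun r => ?_)
        change φ.1 (MulAut.conjNormal (1 : P)⁻¹ r) = φ.1 r
        simp
      mul_smul := fun g h φ => by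
        refine Subtype.ext (MonoidHom.ext fun r => ?_)
        change φ.1 (MulAut.conjNormal (g * h)⁻¹ r) =
          φ.1 (MulAut.conjNormal h⁻¹ (MulAut.conjNormal g⁻¹ r))
        rw [mul_inv_rev, map_mul, MulAut.mul_apply] }
  have hA : IsPGroup p A := fun φ => ⟨1, by
    refine Subtype.ext (MonoidHom.ext fun r => ?_)
    change φ.1 r ^ p ^ 1 = 1
    rw [pow_one]
    have h1 : Nat.card (Multiplicative (ZMod p)) = p := by simp
    have h2 : φ.1 r ^ Nat.card (Multiplicative (ZMod p)) = 1 := pow_card_eq_one'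
    rwa [h1] at h2⟩
  have hne : Nontrivial A := by
    obtain ⟨φ, hφ, hφN⟩ := (hP.to_subgroup R).exists_hom_ne_one (N.subgroupOf R)
      (by rwa [Ne, Subgroup.subgroupOf_eq_top])
    refine ⟨⟨⟨φ, fun r hr => hφN r hr⟩, 1, fun h => hφ (congrArg Subtype.val h)⟩⟩
  have hdvd : p ∣ Nat.card A := by
    obtain ⟨n, hn0, hn⟩ := hA.nontrivial_iff_card.1 hne
    rw [hn]
    exact dvd_pow_self p hn0.ne'
  have hone : (1 : A) ∈ MulAction.fixedPoints P A := fun g => rfl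
  obtain ⟨φ, hφ, hφ1⟩ := hP.exists_fixed_point_of_prime_dvd_card_of_fixed_point A hdvd hone
  refine ⟨φ.1, fun h => hφ1 (Subtype.ext h).symm, φ.2, fun g r => ?_⟩
  have h1 := DFunLike.congr_fun (congrArg Subtype.val (hφ g⁻¹)) r
  change φ.1 (MulAut.conjNormal g⁻¹⁻¹ r) = φ.1 r at h1
  rwa [inv_inv] at h1

variable {F : Type*} [Group F] [TopologicalSpace F]
variable [IsTopologicalGroup F] [hF : IsProP p F]

theorem IsProP.exists_openNormalSubgroup_subset (p : ℕ) [hF : IsProP p F] {W : Set F}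
    (hW : IsOpen W) (h1 : (1 : F) ∈ W) : ∃ U : OpenNormalSubgroup F, (U : Set F) ⊆ W := by
  have := hF.compactSpace
  have := hF.totallyDisconnectedSpace
  exact ProfiniteGrp.exist_openNormalSubgroup_sub_open_nhds_of_one hW h1

theorem IsProP.exists_openNormalSubgroup_notMem_map (p : ℕ) [hF : IsProP p F] {H : Subgroup F}
    (hH : IsClosed (H : Set F)) {g : F} (hg : g ∉ H) :
    ∃ U : OpenNormalSubgroup F,
      (g : F ⧸ U.toSubgroup) ∉ H.map (QuotientGroup.mk' U.toSubgroup) := by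
  obtain ⟨U, hU⟩ := IsProP.exists_openNormalSubgroup_subset p
    (W := {u | g * u ∉ H}) (hH.isOpen_compl.preimage (continuous_const_mul g)) (by simpa using hg)
  refine ⟨U, ?_⟩
  rintro ⟨h, hh, hhg⟩
  refine hU (show g⁻¹ * h ∈ U.toSubgroup from QuotientGroup.eq.1 hhg.symm) ?_
  rwa [mul_inv_cancel_left]

theorem IsProP.finite_quotient (p : ℕ) [hF : IsProP p F] (U : OpenNormalSubgroup F) :
    Finite (F ⧸ U.toSubgroup) := by
  have := hF.compactSpace
  exact Subgroup.quotient_finite_of_isOpen U.toSubgroup U.isOpen'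

theorem continuous_comp_mk {X Q : Type*} [TopologicalSpace X] (U : OpenNormalSubgroup F)
    {f : X → F} (hf : Continuous f) {S : Set (F ⧸ U.toSubgroup)}
    (hS : ∀ x, (f x : F ⧸ U.toSubgroup) ∈ S) (φ : S → Q) [TopologicalSpace Q] :
    Continuous fun x => φ ⟨f x, hS x⟩ := by
  have : DiscreteTopology (F ⧸ U.toSubgroup) := QuotientGroup.discreteTopology U.isOpen'
  exact continuous_of_discreteTopology.comp
    ((QuotientGroup.continuous_mk.comp hf).subtype_mk hS)

/-- A closed subgroup killed by no nonzero continuous homomorphism to `𝔽_p` is the whole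
pro-`p`-group. -/
theorem eq_top_of_forall_ctsHom {H : Subgroup F} (hH : IsClosed (H : Set F))
    (h : ∀ χ ∈ ctsHom p F, (∀ x ∈ H, χ x = 0) → χ = 0) : H = ⊤ := by
  by_contra hne
  obtain ⟨g, hg⟩ : ∃ g, g ∉ H := by
    by_contra! hall
    exact hne ((Subgroup.eq_top_iff' H).2 hall)
  obtain ⟨U, hU⟩ := IsProP.exists_openNormalSubgroup_notMem_map p hH hg
  have := IsProP.finite_quotient p U
  obtain ⟨φ, hφ1, hφ⟩ := (hF.isPGroup_quotient U).exists_hom_ne_one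
    (H.map (QuotientGroup.mk' U.toSubgroup)) fun htop => hU (htop ▸ Subgroup.mem_top _)
  let χ : C(F, ZMod p) := ⟨fun x => (φ (x : F ⧸ U.toSubgroup)).toAdd,
    continuous_comp_mk U continuous_id (S := Set.univ) (fun _ => trivial)
      fun x => (φ x).toAdd⟩
  have hχ : χ = 0 := h χ (fun x y => by
      change (φ ((x * y : F) : F ⧸ U.toSubgroup)).toAdd = _
      rw [QuotientGroup.mk_mul, map_mul]; rfl)
    fun x hx => congrArg Multiplicative.toAdd (hφ _ ⟨x, hx, rfl⟩)
  refine hφ1 (MonoidHom.ext fun x => ?_)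
  obtain ⟨x, rfl⟩ := QuotientGroup.mk_surjective x
  exact congrArg Multiplicative.ofAdd (DFunLike.congr_fun hχ x)

/-- A closed normal subgroup `N` of a pro-`p`-group contains a normal subgroup `R` as soon as no
nonzero invariant homomorphism `R → 𝔽_p` kills `R ∩ N`. -/
theorem le_of_forall_invariantHom {R N : Subgroup F} [R.Normal] [N.Normal]
    (hN : IsClosed (N : Set F))
    (h : ∀ φ ∈ invariantHom p R, (∀ r : R, (r : F) ∈ N → φ r = 0) → φ = 0) : R ≤ N := by
  intro g hgR
  by_contra hg
  obtain ⟨U, hU⟩ := IsProP.exists_openNormalSubgroup_notMem_map p hN hg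
  have := IsProP.finite_quotient p U
  let π := QuotientGroup.mk' U.toSubgroup
  have : (R.map π).Normal := Subgroup.Normal.map inferInstance π (QuotientGroup.mk'_surjective _)
  have : (N.map π).Normal := Subgroup.Normal.map inferInstance π (QuotientGroup.mk'_surjective _)
  obtain ⟨φ, hφ1, hφN, hφ⟩ := (hF.isPGroup_quotient U).exists_invariant_hom_ne_one
    (R.map π) (N.map π) fun hle => hU (hle ⟨g, hgR, rfl⟩)
  let ψ : C(R, ZMod p) := ⟨fun x => (φ ⟨π x, x, x.2, rfl⟩).toAdd,
    continuous_comp_mk U (f := fun x : R => (x : F)) continuous_subtype_val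
      (S := (R.map π : Set (F ⧸ U.toSubgroup))) (fun x => ⟨x, x.2, rfl⟩)
      fun x : R.map π => (φ x).toAdd⟩
  have hψ : ψ = 0 := by
    refine h ψ ⟨fun r s => ?_, fun x r => ?_⟩ fun r hr => ?_
    · exact congrArg Multiplicative.toAdd
        (map_mul φ (⟨π r, r, r.2, rfl⟩ : R.map π) (⟨π s, s, s.2, rfl⟩ : R.map π))
    · exact congrArg Multiplicative.toAdd (hφ (π x) ⟨π r, r, r.2, rfl⟩)
    · exact congrArg Multiplicative.toAdd (hφN ⟨π r, r, r.2, rfl⟩ ⟨r, hr, rfl⟩)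
  refine hφ1 (MonoidHom.ext fun x => ?_)
  obtain ⟨_, r, hr, rfl⟩ := x
  exact congrArg Multiplicative.ofAdd (DFunLike.congr_fun hψ ⟨r, hr⟩)

end Separation

/-! ### Free pro-`p`-groups have cohomological dimension at most one -/

section TwistedProduct

variable {p : ℕ} {F : Type*} [Group F] [TopologicalSpace F]

theorem twoCocycle_one_left (c : twoCocycle p F) (x : F) : c.1 (1, x) = c.1 (1, 1) := by
  have h := c.2 1 1 x
  rw [one_mul, one_mul] at h
  exact add_left_cancel h

theorem twoCocycle_one_right (c : twoCocycle p F) (x : F) : c.1 (x, 1) = c.1 (1, 1) := by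
  have h := c.2 x 1 1
  rw [mul_one, mul_one] at h
  exact (add_right_cancel h).symm

/-- The extension of `F` by `𝔽_p` defined by a `2`-cocycle `c`: the set `𝔽_p × F` with the product
`(a, x) (b, y) = (a + b + c (x, y), x y)`. -/
def TwistedProduct (_ : twoCocycle p F) : Type _ := ZMod p × F

namespace TwistedProduct

variable (c : twoCocycle p F)

instance : TopologicalSpace (TwistedProduct c) :=
  inferInstanceAs (TopologicalSpace (ZMod p × F))

instance : Mul (TwistedProduct c) := ⟨fun e f => (e.1 + f.1 + c.1 (e.2, f.2), e.2 * f.2)⟩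

-- The cocycle is not assumed to be normalised, so that the neutral element is `(-c (1, 1), 1)`.
instance : One (TwistedProduct c) := ⟨(-c.1 (1, 1), 1)⟩

instance : Inv (TwistedProduct c) :=
  ⟨fun e => (-e.1 - c.1 (e.2⁻¹, e.2) - c.1 (1, 1), e.2⁻¹)⟩

instance : Group (TwistedProduct c) :=
  Group.ofLeftAxioms (G := TwistedProduct c)
    (fun e f g => Prod.ext (by
      change e.1 + f.1 + c.1 (e.2, f.2) + g.1 + c.1 (e.2 * f.2, g.2) =
        e.1 + (f.1 + g.1 + c.1 (f.2, g.2)) + c.1 (e.2, f.2 * g.2)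
      linear_combination -c.2 e.2 f.2 g.2) (mul_assoc e.2 f.2 g.2))
    (fun e => Prod.ext (by
      change -c.1 (1, 1) + e.1 + c.1 (1, e.2) = e.1
      rw [twoCocycle_one_left c e.2]; ring) (one_mul e.2))
    (fun e => Prod.ext (by
      change -e.1 - c.1 (e.2⁻¹, e.2) - c.1 (1, 1) + e.1 + c.1 (e.2⁻¹, e.2) = -c.1 (1, 1)
      ring) (inv_mul_cancel e.2))

theorem mul_def (e f : TwistedProduct c) :
    e * f = (e.1 + f.1 + c.1 (e.2, f.2), e.2 * f.2) := rfl

instance [IsTopologicalGroup F] : IsTopologicalGroup (TwistedProduct c) where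
  continuous_mul := by
    change Continuous fun q : (ZMod p × F) × (ZMod p × F) =>
      ((q.1.1 + q.2.1 + c.1 (q.1.2, q.2.2), q.1.2 * q.2.2) : ZMod p × F)
    fun_prop
  continuous_inv := by
    change Continuous fun q : ZMod p × F =>
      ((-q.1 - c.1 (q.2⁻¹, q.2) - c.1 (1, 1), q.2⁻¹) : ZMod p × F)
    fun_prop

/-- The projection of the extension onto `F`. -/
def proj : TwistedProduct c →ₜ* F where
  toFun e := e.2
  map_one' := rfl
  map_mul' _ _ := rfl
  continuous_toFun := continuous_snd

theorem pow_of_proj_eq_one {e : TwistedProduct c} (he : proj c e = 1) (n : ℕ) :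
    e ^ n = (n * e.1 + (n - 1) * c.1 (1, 1), 1) := by
  have he2 : e.2 = 1 := he
  induction n with
  | zero =>
    refine Prod.ext ?_ rfl
    change -c.1 (1, 1) = ((0 : ℕ) : ZMod p) * e.1 + (((0 : ℕ) : ZMod p) - 1) * c.1 (1, 1)
    push_cast
    ring
  | succ n ih =>
    rw [pow_succ, ih]
    refine Eq.trans (mul_def c _ e) ?_
    refine Prod.ext ?_ ?_
    · change n * e.1 + (n - 1) * c.1 (1, 1) + e.1 + c.1 (1, e.2) =
        ((n + 1 : ℕ) : ZMod p) * e.1 + (((n + 1 : ℕ) : ZMod p) - 1) * c.1 (1, 1)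
      rw [he2]
      push_cast
      ring
    · change 1 * e.2 = 1
      rw [he2, one_mul]

theorem pow_prime_of_proj_eq_one {e : TwistedProduct c} (he : proj c e = 1) : e ^ p = 1 := by
  rw [pow_of_proj_eq_one c he]
  refine Prod.ext ?_ rfl
  change (p : ZMod p) * e.1 + ((p : ZMod p) - 1) * c.1 (1, 1) = -c.1 (1, 1)
  rw [CharP.cast_eq_zero]
  ring

instance [Fact p.Prime] [IsTopologicalGroup F] [hF : IsProP p F] :
    IsProP p (TwistedProduct c) where
  compactSpace := by
    have := hF.compactSpace
    exact inferInstanceAs (CompactSpace (ZMod p × F))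
  totallyDisconnectedSpace := by
    have := hF.totallyDisconnectedSpace
    exact inferInstanceAs (TotallyDisconnectedSpace (ZMod p × F))
  isPGroup_quotient U := by
    have hopen : IsOpenMap (proj c) := isOpenMap_snd (X := ZMod p) (Y := F)
    have hsurj : Function.Surjective (proj c) := fun x => ⟨((0 : ZMod p), x), rfl⟩
    obtain ⟨V, hV⟩ : ∃ V : OpenNormalSubgroup F,
        V.toSubgroup = U.toSubgroup.map (proj c : TwistedProduct c →* F) :=
      ⟨{ toSubgroup := U.toSubgroup.map (proj c : TwistedProduct c →* F)
         isOpen' := hopen _ U.isOpen'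
         isNormal' := Subgroup.Normal.map U.isNormal' _ hsurj }, rfl⟩
    rintro ⟨e⟩
    obtain ⟨k, hk⟩ := hF.isPGroup_quotient V (proj c e : F)
    rw [← QuotientGroup.mk_pow, QuotientGroup.eq_one_iff, ← map_pow, hV] at hk
    obtain ⟨u, hu, hue⟩ := hk
    have h1 : (u⁻¹ * e ^ p ^ k) ^ p = 1 := pow_prime_of_proj_eq_one c (by
      rw [map_mul, map_inv, inv_mul_eq_one]
      exact hue)
    have h2 : (QuotientGroup.mk (u⁻¹ * e ^ p ^ k) : TwistedProduct c ⧸ U.toSubgroup) =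
        QuotientGroup.mk (e ^ p ^ k) := by
      rw [QuotientGroup.mk_mul, QuotientGroup.mk_inv, (QuotientGroup.eq_one_iff u).2 hu, inv_one,
        one_mul]
    refine ⟨k + 1, ?_⟩
    change (QuotientGroup.mk e : TwistedProduct c ⧸ U.toSubgroup) ^ p ^ (k + 1) = 1
    rw [pow_succ, pow_mul, ← QuotientGroup.mk_pow, ← h2, ← QuotientGroup.mk_pow, h1,
      QuotientGroup.mk_one]

end TwistedProduct

/-- The extension defined by a cocycle of a free pro-`p`-group splits, because the free generators
can be lifted. -/
theorem FreeProP.exists_coboundary_eq [Fact p.Prime] {n : ℕ} (c : twoCocycle p (FreeProP p n)) :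
    ∃ b, coboundary p b = c.1 := by
  obtain ⟨f, hf, -⟩ := existsUnique_hom p n (H := TwistedProduct c)
    fun i => ((0 : ZMod p), gen p i)
  have hid : ∀ x, (f x).2 = x := by
    obtain ⟨g, -, hg⟩ := existsUnique_hom p n (gen p (n := n))
    have h1 := hg ((TwistedProduct.proj c).comp f) fun i => congrArg Prod.snd (hf i)
    have h2 := hg (ContinuousMonoidHom.id _) fun i => rfl
    exact fun x => DFunLike.congr_fun (h1.trans h2.symm) x
  have hfc : Continuous fun x => (f x).1 := continuous_fst.comp f.continuous_toFun
  refine ⟨-⟨fun x => (f x).1, hfc⟩, ?_⟩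
  ext ⟨x, y⟩
  change -(f x).1 + -(f y).1 - -(f (x * y)).1 = c.1 (x, y)
  have h3 : (f (x * y)).1 = (f x).1 + (f y).1 + c.1 ((f x).2, (f y).2) :=
    congrArg Prod.fst (map_mul f x y)
  rw [h3, hid, hid]
  ring

/-- Continuous homomorphisms from the free pro-`p`-group to `𝔽_p` are determined by arbitrary values
on the free generators. -/
theorem FreeProP.exists_ctsHom_gen [Fact p.Prime] {n : ℕ} (h : Fin n → ZMod p) :
    ∃ χ ∈ ctsHom p (FreeProP p n), ∀ i, χ (gen p i) = h i := by
  let T := Multiplicative (ZMod p)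
  have : IsProP p T :=
    { compactSpace := inferInstance
      totallyDisconnectedSpace := inferInstanceAs (TotallyDisconnectedSpace (ZMod p))
      isPGroup_quotient := fun U => by
        refine IsPGroup.to_quotient (G := T) (fun x => ⟨1, ?_⟩) U.toSubgroup
        rw [pow_one]
        have h1 : Nat.card T = p := by simp [T]
        have h2 : x ^ Nat.card T = 1 := pow_card_eq_one'
        rwa [h1] at h2 }
  obtain ⟨f, hf, -⟩ := existsUnique_hom p n (H := T) fun i => Multiplicative.ofAdd (h i)
  exact ⟨⟨fun x => (f x).toAdd, f.continuous_toFun⟩, fun x y =>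
    congrArg Multiplicative.toAdd (map_mul f x y), fun i => congrArg Multiplicative.toAdd (hf i)⟩

theorem FreeProP.eq_zero_of_gen [Fact p.Prime] {n : ℕ} {χ : C(FreeProP p n, ZMod p)}
    (hχ : χ ∈ ctsHom p (FreeProP p n)) (h : ∀ i, χ (gen p i) = 0) : χ = 0 := by
  let K : Subgroup (FreeGroup (Fin n)) :=
    { carrier := {g | χ (ProPCompletion.of g) = 0}
      one_mem' := by
        change χ (ProPCompletion.of 1) = 0
        rw [map_one]; exact map_one_of_mem_ctsHom hχ
      mul_mem' := fun {a b} (ha : _ = 0) (hb : _ = 0) => by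
        change χ (ProPCompletion.of (a * b)) = 0
        rw [map_mul, hχ, ha, hb, add_zero]
      inv_mem' := fun {a} (ha : _ = 0) => by
        change χ (ProPCompletion.of a⁻¹) = 0
        rw [map_inv, map_inv_of_mem_ctsHom hχ, ha, neg_zero] }
  have hK : K = ⊤ := by
    rw [eq_top_iff, ← FreeGroup.closure_range_of, Subgroup.closure_le]
    rintro _ ⟨i, rfl⟩
    exact h i
  have h1 : ⇑χ = ⇑(0 : C(FreeProP p n, ZMod p)) :=
    (ProPCompletion.denseRange_of p _).equalizer χ.continuous continuous_const
      (funext fun g => (show g ∈ K from hK ▸ Subgroup.mem_top g))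
  exact DFunLike.coe_injective h1

end TwistedProduct

/-! ### The transgression -/

section Transgression

open Topology

theorem LinearMap.exists_comp_eq_of_ker_le {k V W X : Type*} [Ring k] [AddCommGroup V]
    [AddCommGroup W] [AddCommGroup X] [Module k V] [Module k W] [Module k X] (f : V →ₗ[k] W)
    (g : V →ₗ[k] X) (hf : Function.Surjective f) (h : LinearMap.ker f ≤ LinearMap.ker g) :
    ∃ t : W →ₗ[k] X, ∀ v, t (f v) = g v := by
  refine ⟨(Submodule.liftQ _ g h).comp (f.quotKerEquivOfSurjective hf).symm.toLinearMap,
    fun v => ?_⟩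
  have h1 : (f.quotKerEquivOfSurjective hf).symm (f v) = Submodule.Quotient.mk v := by
    rw [LinearEquiv.symm_apply_eq]; rfl
  change Submodule.liftQ _ g h ((f.quotKerEquivOfSurjective hf).symm (f v)) = g v
  rw [h1]
  rfl

variable {p : ℕ} {F : Type*} [Group F] [TopologicalSpace F] [IsTopologicalGroup F]

/-- An invariant homomorphism `φ : R → 𝔽_p` on a normal subgroup of a pro-`p`-group `F` extends to a
continuous function on `F` that is compatible with right translation by `R`. -/
theorem exists_extension_invariantHom [hF : IsProP p F] (R : Subgroup F) [R.Normal]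
    (φ : C(R, ZMod p)) (hφ : φ ∈ invariantHom p R) :
    ∃ b : C(F, ZMod p), ∀ (x : F) (r : R), b (x * r) = b x + φ r := by
  -- By continuity `φ` vanishes on `U ∩ R` for some open normal subgroup `U`.
  obtain ⟨V, hV, hVφ⟩ := isOpen_induced_iff.1
    ((isOpen_discrete {(0 : ZMod p)}).preimage φ.continuous)
  have hV1 : (1 : F) ∈ V := by
    have h1 : (1 : R) ∈ (Subtype.val : R → F) ⁻¹' V := hVφ ▸ map_one_of_mem_invariantHom hφ
    exact h1
  obtain ⟨U, hU⟩ := IsProP.exists_openNormalSubgroup_subset p hV hV1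
  have hUφ : ∀ r : R, (r : F) ∈ U.toSubgroup → φ r = 0 := fun r hr => by
    have h1 : r ∈ (Subtype.val : R → F) ⁻¹' V := hU hr
    rw [hVφ] at h1
    exact h1
  -- The extension is `y u r ↦ φ r` for fixed representatives `y` of the cosets of `U R`, where
  -- `u ∈ U` and `r ∈ R`.
  let S := U.toSubgroup ⊔ R
  let rep : F → F := fun x => (QuotientGroup.mk x : F ⧸ S).out
  have hrep : ∀ x, ∃ u ∈ U.toSubgroup, ∃ r : R, x = rep x * u * r := fun x => by
    have h1 : (rep x)⁻¹ * x ∈ S := QuotientGroup.eq.1 (QuotientGroup.out_eq' _)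
    obtain ⟨u, hu, r, hr, hur⟩ := Subgroup.mem_sup_of_normal_left.1 h1
    exact ⟨u, hu, ⟨r, hr⟩, by rw [mul_assoc, hur, mul_inv_cancel_left]⟩
  choose u hu r hr using hrep
  have hrep_eq : ∀ x y, x⁻¹ * y ∈ S → rep x = rep y := fun x y h =>
    congrArg Quotient.out (QuotientGroup.eq.2 h : (x : F ⧸ S) = y)
  have key : ∀ (y v w : F) (s t : R), v ∈ U.toSubgroup → w ∈ U.toSubgroup →
      y * v * s = y * w * t → φ s = φ t := fun y v w s t hv hw h => by
    have h1 : φ (s * t⁻¹) = 0 := hUφ _ (by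
      have h2 : (s * t⁻¹ : F) = v⁻¹ * w := by
        rw [Subgroup.coe_inv, mul_inv_eq_iff_eq_mul, mul_assoc, eq_inv_mul_iff_mul_eq]
        simpa [mul_assoc] using h
      change (s * t⁻¹ : F) ∈ U.toSubgroup
      rw [h2]
      exact mul_mem (inv_mem hv) hw)
    rw [hφ.1, map_inv_of_mem_invariantHom hφ] at h1
    exact add_neg_eq_zero.1 h1
  have hb_cont : Continuous fun x => φ (r x) := by
    refine (IsLocallyConstant.iff_exists_open _).2 (fun x => ?_) |>.continuous
    refine ⟨{y | x⁻¹ * y ∈ U.toSubgroup}, U.isOpen'.preimage (continuous_const_mul x⁻¹), by simp,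
      fun y hy => ?_⟩
    have h1 : rep x = rep y := hrep_eq x y (Subgroup.mem_sup_left hy)
    refine key (rep x) (u y) (u x * (r x * (x⁻¹ * y) * (r x)⁻¹)) _ _ (hu y)
      (mul_mem (hu x) (Subgroup.Normal.conj_mem inferInstance _ hy _)) ?_
    have h2 : rep x * (u x * (r x * (x⁻¹ * y) * (r x : F)⁻¹)) * r x =
        rep x * u x * r x * (x⁻¹ * y) := by group
    rw [Subgroup.coe_inv, h2, ← hr x, h1, ← hr y]
    group
  refine ⟨⟨_, hb_cont⟩, fun x s => ?_⟩
  have h1 : rep (x * s) = rep x := (hrep_eq x (x * s)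
    (Subgroup.mem_sup_right (by rw [inv_mul_cancel_left]; exact s.2))).symm
  change φ (r (x * s)) = φ (r x) + φ s
  rw [← hφ.1]
  refine key (rep x) (u (x * s)) (u x) _ _ (hu _) (hu _) ?_
  rw [Subgroup.coe_mul, ← mul_assoc, ← hr x, ← h1, ← hr]

universe u

variable [hF : IsProP p F] {G : Type u} [Group G] [TopologicalSpace G] [IsTopologicalGroup G]
  [hG : IsProP p G]

theorem IsProP.isQuotientMap (p : ℕ) [hF : IsProP p F] [hG : IsProP p G] {f : F →ₜ* G}
    (hf : Function.Surjective f) : IsQuotientMap f := by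
  have := hF.compactSpace
  have := hG.compactSpace
  have := hG.totallyDisconnectedSpace
  have : T2Space G := inferInstance
  exact f.continuous_toFun.isClosedMap.isQuotientMap f.continuous_toFun hf

theorem IsProP.isQuotientMap_prodMap (p : ℕ) [hF : IsProP p F] [hG : IsProP p G] {f : F →ₜ* G}
    (hf : Function.Surjective f) : IsQuotientMap (Prod.map f f) := by
  have := hF.compactSpace
  have := hG.compactSpace
  have := hG.totallyDisconnectedSpace
  have : T2Space G := inferInstance
  have hc : Continuous (Prod.map f f) := f.continuous_toFun.prodMap f.continuous_toFun
  exact hc.isClosedMap.isQuotientMap hc (hf.prodMap hf)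

/-- A continuous function that is constant on the cosets of the kernel of `f : F → G` descends to
`G`, because `f` is a quotient map. -/
theorem exists_comp_eq_of_forall_ker {f : F →ₜ* G} (hf : Function.Surjective f)
    (b : C(F, ZMod p)) (hb : ∀ (x : F) (r : (f : F →* G).ker), b (x * r) = b x) :
    ∃ a : C(G, ZMod p), ∀ x, a (f x) = b x := by
  have hfac : ∀ x y, f x = f y → b x = b y := fun x y h => by
    have h1 : x⁻¹ * y ∈ (f : F →* G).ker := by
      change f (x⁻¹ * y) = 1
      rw [map_mul, map_inv, h, inv_mul_cancel]
    have h2 := hb x ⟨_, h1⟩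
    rw [mul_inv_cancel_left] at h2
    exact h2.symm
  let q : IsQuotientMap (f : C(F, G)) := IsProP.isQuotientMap p hf
  exact ⟨q.lift b hfac, fun x => DFunLike.congr_fun (q.lift_comp b hfac) x⟩

/-- The coboundary of a function on `F` that is compatible with translation by the kernel of
`f : F → G` descends to a cocycle of `G`. -/
theorem exists_twoCocycle_comp_eq {f : F →ₜ* G} (hf : Function.Surjective f)
    {φ : C((f : F →* G).ker, ZMod p)} (hφ : φ ∈ invariantHom p (f : F →* G).ker)
    {b : C(F, ZMod p)} (hb : ∀ (x : F) (r : (f : F →* G).ker), b (x * r) = b x + φ r) :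
    ∃ c : twoCocycle p G, ∀ x y, c.1 (f x, f y) = coboundary p b (x, y) := by
  have hker : ∀ x x', f x = f x' → ∃ r : (f : F →* G).ker, x' = x * r := fun x x' h =>
    ⟨⟨x⁻¹ * x', by
      change f (x⁻¹ * x') = 1
      rw [map_mul, map_inv, h, inv_mul_cancel]⟩, by rw [mul_inv_cancel_left]⟩
  have hfac : ∀ q q' : F × F, Prod.map f f q = Prod.map f f q' →
      coboundary p b q = coboundary p b q' := by
    rintro ⟨x, y⟩ ⟨x', y'⟩ h
    obtain ⟨r, rfl⟩ := hker x x' (congrArg Prod.fst h)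
    obtain ⟨s, rfl⟩ := hker y y' (congrArg Prod.snd h)
    change b x + b y - b (x * y) = b (x * r) + b (y * s) - b (x * r * (y * s))
    have h1 : x * r * (y * s) =
        x * y * ((MulAut.conjNormal y⁻¹ r * s : (f : F →* G).ker) : F) := by
      rw [Subgroup.coe_mul, MulAut.conjNormal_apply]
      group
    rw [h1, hb, hb, hb, hφ.1, hφ.2]
    ring
  let q : IsQuotientMap (⟨Prod.map f f, f.continuous_toFun.prodMap f.continuous_toFun⟩ :
    C(F × F, G × G)) := IsProP.isQuotientMap_prodMap p hf
  have hc : ∀ x y, q.lift (coboundary p b) hfac (f x, f y) = coboundary p b (x, y) := fun x y =>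
    DFunLike.congr_fun (q.lift_comp (coboundary p b) hfac) (x, y)
  refine ⟨⟨q.lift (coboundary p b) hfac, fun g h k => ?_⟩, hc⟩
  obtain ⟨x, rfl⟩ := hf g
  obtain ⟨y, rfl⟩ := hf h
  obtain ⟨z, rfl⟩ := hf k
  rw [← map_mul, ← map_mul, hc, hc, hc, hc]
  change (b y + b z - b (y * z)) + (b x + b (y * z) - b (x * (y * z))) =
    (b (x * y) + b z - b (x * y * z)) + (b x + b y - b (x * y))
  rw [mul_assoc]
  ring

/-- For a continuous surjection `f : F → G` with kernel `R`, an invariant homomorphism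
`φ : R → 𝔽_p` is sent to the class of the cocycle of `G` obtained from the coboundary of any
extension `b` of `φ` with `b (x r) = b x + φ r`. -/
theorem exists_transgression {f : F →ₜ* G} (hf : Function.Surjective f) :
    ∃ t : invariantHom p (f : F →* G).ker →ₗ[ZMod p] HFp p G 2,
      ∀ (φ : invariantHom p (f : F →* G).ker) (b : C(F, ZMod p)) (c : twoCocycle p G),
        (∀ (x : F) (r : (f : F →* G).ker), b (x * r) = b x + φ.1 r) →
        (∀ x y, c.1 (f x, f y) = coboundary p b (x, y)) → t φ = classTwo p c := by
  -- `B` consists of the homomorphisms `φ` together with a choice of extension `b`.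
  let B : Submodule (ZMod p) (invariantHom p (f : F →* G).ker × C(F, ZMod p)) :=
    { carrier := {q | ∀ (x : F) (r : (f : F →* G).ker), q.2 (x * r) = q.2 x + q.1.1 r}
      zero_mem' := fun x r => by
        change (0 : ZMod p) = 0 + 0
        rw [add_zero]
      add_mem' := fun {q q'} hq hq' x r => by
        change q.2 (x * r) + q'.2 (x * r) = q.2 x + q'.2 x + (q.1.1 r + q'.1.1 r)
        rw [hq, hq']; ring
      smul_mem' := fun a q hq x r => by
        change a * q.2 (x * r) = a * q.2 x + a * q.1.1 r
        rw [hq]; ring }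
  have hcoc : ∀ q : B, ∃ c : twoCocycle p G, ∀ x y, c.1 (f x, f y) = coboundary p q.1.2 (x, y) :=
    fun q => exists_twoCocycle_comp_eq hf q.1.1.2 q.2
  choose coc hcoc using hcoc
  have hext : ∀ c d : twoCocycle p G, (∀ x y, c.1 (f x, f y) = d.1 (f x, f y)) → c = d := by
    intro c d h
    refine Subtype.ext (ContinuousMap.ext fun ⟨g, h'⟩ => ?_)
    obtain ⟨x, rfl⟩ := hf g
    obtain ⟨y, rfl⟩ := hf h'
    exact h x y
  let coc' : B →ₗ[ZMod p] twoCocycle p G :=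
    { toFun := coc
      map_add' := fun q q' => hext _ _ fun x y => by
        change (coc (q + q')).1 (f x, f y) = (coc q).1 (f x, f y) + (coc q').1 (f x, f y)
        rw [hcoc, hcoc, hcoc]
        change q.1.2 x + q'.1.2 x + (q.1.2 y + q'.1.2 y) - (q.1.2 (x * y) + q'.1.2 (x * y)) =
          (q.1.2 x + q.1.2 y - q.1.2 (x * y)) + (q'.1.2 x + q'.1.2 y - q'.1.2 (x * y))
        ring
      map_smul' := fun a q => hext _ _ fun x y => by
        change (coc (a • q)).1 (f x, f y) = a * (coc q).1 (f x, f y)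
        rw [hcoc, hcoc]
        change a * q.1.2 x + a * q.1.2 y - a * q.1.2 (x * y) =
          a * (q.1.2 x + q.1.2 y - q.1.2 (x * y))
        ring }
  -- The pairs `(φ, b)` with `φ = 0` come from functions on `G`, so that their cocycles are
  -- coboundaries and the class depends on `φ` only.
  obtain ⟨t, ht⟩ := LinearMap.exists_comp_eq_of_ker_le
    ((LinearMap.fst _ _ _).comp B.subtype) ((classTwo p).comp coc') (fun φ => by
      obtain ⟨b, hb⟩ := exists_extension_invariantHom _ φ.1 φ.2
      exact ⟨⟨(φ, b), hb⟩, rfl⟩) (fun q hq => by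
      have hq1 : q.1.1 = 0 := hq
      obtain ⟨a, ha⟩ := exists_comp_eq_of_forall_ker hf q.1.2 fun x r => by
        rw [q.2, hq1]
        exact add_zero _
      refine (classTwo_eq_zero_iff p (coc q)).2 ⟨a, ContinuousMap.ext fun ⟨g, h⟩ => ?_⟩
      obtain ⟨x, rfl⟩ := hf g
      obtain ⟨y, rfl⟩ := hf h
      rw [hcoc]
      change a (f x) + a (f y) - a (f x * f y) = q.1.2 x + q.1.2 y - q.1.2 (x * y)
      rw [← map_mul, ha, ha, ha])
  refine ⟨t, fun φ b c hb hc => ?_⟩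
  refine (ht ⟨(φ, b), hb⟩).trans (congrArg (classTwo p) (hext _ _ fun x y => ?_))
  exact (hcoc _ x y).trans (hc x y).symm

/-- The transgression `H¹(R, 𝔽_p)^F → H²(G, 𝔽_p)` of a continuous surjection `F → G` with
kernel `R`. -/
noncomputable def transgression {f : F →ₜ* G} (hf : Function.Surjective f) :
    invariantHom p (f : F →* G).ker →ₗ[ZMod p] HFp p G 2 :=
  (exists_transgression hf).choose

theorem transgression_eq {f : F →ₜ* G} (hf : Function.Surjective f)
    (φ : invariantHom p (f : F →* G).ker) (b : C(F, ZMod p)) (c : twoCocycle p G)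
    (hb : ∀ (x : F) (r : (f : F →* G).ker), b (x * r) = b x + φ.1 r)
    (hc : ∀ x y, c.1 (f x, f y) = coboundary p b (x, y)) :
    transgression hf φ = classTwo p c :=
  (exists_transgression hf).choose_spec φ b c hb hc

/-- Exactness at `H¹(R, 𝔽_p)^F`: the kernel of the transgression consists of the restrictions of
homomorphisms on `F`. -/
theorem transgression_eq_zero_iff {f : F →ₜ* G} (hf : Function.Surjective f)
    (φ : invariantHom p (f : F →* G).ker) :
    transgression hf φ = 0 ↔ ∃ χ ∈ ctsHom p F, ∀ r : (f : F →* G).ker, χ r = φ.1 r := by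
  constructor
  · intro h
    obtain ⟨b, hb⟩ := exists_extension_invariantHom _ φ.1 φ.2
    obtain ⟨c, hc⟩ := exists_twoCocycle_comp_eq hf φ.2 hb
    rw [transgression_eq hf φ b c hb hc, classTwo_eq_zero_iff] at h
    obtain ⟨a, ha⟩ := h
    -- Subtracting from `b` the inflation of a cochain with the same coboundary leaves a
    -- homomorphism.
    let χ : C(F, ZMod p) := b - ⟨fun x => a (f x), a.continuous.comp f.continuous_toFun⟩
    have hχ : χ ∈ ctsHom p F := fun x y => by
      have h1 := hc x y
      rw [← ha] at h1
      change a (f x) + a (f y) - a (f x * f y) = b x + b y - b (x * y) at h1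
      change b (x * y) - a (f (x * y)) = (b x - a (f x)) + (b y - a (f y))
      rw [map_mul f]
      linear_combination h1
    refine ⟨χ, hχ, fun r => ?_⟩
    have hr : f r = 1 := r.2
    have h1 : χ r = b (1 * r) - a 1 := by
      change b r - a (f r) = _
      rw [hr, one_mul]
    have h2 : b 1 - a 1 = 0 := by
      have h3 : b 1 - a (f 1) = 0 := map_one_of_mem_ctsHom hχ
      rwa [map_one f] at h3
    rw [h1, hb]
    linear_combination h2
  · rintro ⟨χ, hχ, hχφ⟩
    rw [transgression_eq hf φ χ 0 (fun x r => by rw [hχ, hχφ]) fun x y => ?_, map_zero]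
    change 0 = χ x + χ y - χ (x * y)
    rw [hχ, sub_self]

/-- The transgression is surjective when every `2`-cocycle of `F` is a coboundary. -/
theorem transgression_surjective {f : F →ₜ* G} (hf : Function.Surjective f)
    (h : ∀ c : twoCocycle p F, ∃ b, coboundary p b = c.1) :
    Function.Surjective (transgression (p := p) hf) := by
  have := hG.compactSpace
  intro z
  obtain ⟨c, rfl⟩ := classTwo_surjective p z
  obtain ⟨b, hb⟩ := h ⟨⟨fun q => c.1 (f q.1, f q.2), c.1.continuous.comp
    (f.continuous_toFun.prodMap f.continuous_toFun)⟩, fun x y z => by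
      change c.1 (f y, f z) + c.1 (f x, f (y * z)) = c.1 (f (x * y), f z) + c.1 (f x, f y)
      rw [map_mul, map_mul]
      exact c.2 _ _ _⟩
  have hb' : ∀ x y, b x + b y - b (x * y) = c.1 (f x, f y) := fun x y =>
    DFunLike.congr_fun hb (x, y)
  have hb1 : b 1 = c.1 (1, 1) := by
    have h1 := hb' 1 1
    rw [map_one f, mul_one] at h1
    linear_combination h1
  have hright : ∀ (x : F) (r : (f : F →* G).ker), b (x * r) = b x + (b r - b 1) := fun x r => by
    have h1 := hb' x r
    have hr : f r = 1 := r.2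
    rw [hr, twoCocycle_one_right, ← hb1] at h1
    linear_combination -h1
  have hleft : ∀ (r : (f : F →* G).ker) (x : F), b (r * x) = b x + (b r - b 1) := fun r x => by
    have h1 := hb' r x
    have hr : f r = 1 := r.2
    rw [hr, twoCocycle_one_left, ← hb1] at h1
    linear_combination -h1
  let φ : C((f : F →* G).ker, ZMod p) :=
    ⟨fun r => b r - b 1, (b.continuous.comp continuous_subtype_val).sub continuous_const⟩
  have hφ : φ ∈ invariantHom p (f : F →* G).ker := by
    refine ⟨fun r s => ?_, fun x r => ?_⟩
    · change b (r * s) - b 1 = b r - b 1 + (b s - b 1)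
      rw [hright]; ring
    · have h1 := hleft (MulAut.conjNormal x r) x
      rw [MulAut.conjNormal_apply, inv_mul_cancel_right, hright] at h1
      exact (add_left_cancel h1).symm
  exact ⟨⟨φ, hφ⟩, transgression_eq hf ⟨φ, hφ⟩ b c hright fun x y => (hb' x y).symm⟩

/-- The transgression of a `σ`-equivariant surjection commutes with `σ`. -/
theorem sigmaOnHFp_transgression {f : F →ₜ* G} (hf : Function.Surjective f) (t : SigmaAction F)
    (s : SigmaAction G) (hfs : ∀ x, f (t.sigma x) = s.sigma (f x))
    (φ ψ : invariantHom p (f : F →* G).ker)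
    (h : ∀ r r' : (f : F →* G).ker, (r' : F) = t.sigma r → ψ.1 r = φ.1 r') :
    (sigmaOnHFp p s 2).hom (transgression hf φ) = transgression hf ψ := by
  obtain ⟨b, hb⟩ := exists_extension_invariantHom _ φ.1 φ.2
  obtain ⟨c, hc⟩ := exists_twoCocycle_comp_eq hf φ.2 hb
  let d : twoCocycle p G := ⟨⟨fun q => c.1 (s.sigma q.1, s.sigma q.2), c.1.continuous.comp
    (s.sigma.continuous_toFun.prodMap s.sigma.continuous_toFun)⟩, fun x y z => by
      change c.1 (s.sigma y, s.sigma z) + c.1 (s.sigma x, s.sigma (y * z)) =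
        c.1 (s.sigma (x * y), s.sigma z) + c.1 (s.sigma x, s.sigma y)
      rw [map_mul, map_mul]
      exact c.2 _ _ _⟩
  let b' : C(F, ZMod p) := ⟨fun x => b (t.sigma x), b.continuous.comp t.sigma.continuous_toFun⟩
  rw [transgression_eq hf φ b c hb hc, sigmaOnHFp_classTwo s c d fun x y => rfl,
    transgression_eq hf ψ b' d (fun x r => ?_) fun x y => ?_]
  · have hr : t.sigma r ∈ (f : F →* G).ker := by
      change f (t.sigma r) = 1
      rw [hfs, show f r = 1 from r.2, map_one]
    change b (t.sigma (x * r)) = b (t.sigma x) + ψ.1 r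
    rw [map_mul, h r ⟨_, hr⟩ rfl]
    exact hb _ ⟨_, hr⟩
  · change c.1 (s.sigma (f x), s.sigma (f y)) =
      b (t.sigma x) + b (t.sigma y) - b (t.sigma (x * y))
    rw [← hfs, ← hfs, hc, map_mul]
    rfl

end Transgression

/-! ### Odd generators and odd relations -/

section OddPresentation

universe u

/-- If a family of linear forms has no common zero in a space of dimension at most `d`, then neither
have some `d` members of it. The index `i₀` fills up the list if fewer forms suffice. -/
theorem exists_fin_forall_eq_zero {k V ι : Type*} [Field k] [AddCommGroup V] [Module k V]
    [Module.Finite k V] (ev : ι → Module.Dual k V) (h : ∀ v, (∀ i, ev i v = 0) → v = 0) {d : ℕ}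
    (hd : Module.finrank k V ≤ d) (i₀ : ι) :
    ∃ g : Fin d → ι, ∀ v, (∀ j, ev (g j) v = 0) → v = 0 := by
  obtain ⟨κ, a, -, hspan, hli⟩ := exists_linearIndependent' k ev
  have : Finite κ := hli.finite
  have : Fintype κ := Fintype.ofFinite κ
  have hcard : Fintype.card κ ≤ Fintype.card (Fin d) := by
    rw [Fintype.card_fin]
    refine hli.fintype_card_le_finrank.trans ?_
    rwa [Subspace.dual_finrank_eq]
  obtain ⟨e⟩ := Function.Embedding.nonempty_of_card_le hcard
  refine ⟨Function.extend e a fun _ => i₀, fun v hv => h v fun i => ?_⟩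
  have h1 : Submodule.span k (Set.range ev) ≤ LinearMap.ker (Module.Dual.eval k V v) := by
    rw [← hspan, Submodule.span_le]
    rintro _ ⟨j, rfl⟩
    have h2 := hv (e j)
    rwa [e.injective.extend_apply] at h2
  exact h1 (Submodule.subset_span ⟨i, rfl⟩)

variable {p : ℕ}

theorem ZMod.eq_zero_of_add_self [Fact p.Prime] (hp : 2 < p) {a : ZMod p} (h : a + a = 0) :
    a = 0 := by
  have h2 : (2 : ZMod p) ≠ 0 := fun h2 => by
    have h1 := (ZMod.natCast_eq_zero_iff 2 p).1 (by exact_mod_cast h2)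
    exact absurd (Nat.le_of_dvd two_pos h1) (by omega)
  rw [← two_mul] at h
  exact (mul_eq_zero.1 h).resolve_left h2

/-- The inflation `Hom(G, 𝔽_p) → Hom(F, 𝔽_p)` along a continuous homomorphism `f : F → G`. -/
def inflation (p : ℕ) {F G : Type*} [Group F] [TopologicalSpace F] [Group G] [TopologicalSpace G]
    (f : F →ₜ* G) : ctsHom p G →ₗ[ZMod p] ctsHom p F where
  toFun χ := ⟨⟨fun x => χ.1 (f x), χ.1.continuous.comp f.continuous_toFun⟩, fun x y => by
    change χ.1 (f (x * y)) = χ.1 (f x) + χ.1 (f y)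
    rw [map_mul]
    exact χ.2 _ _⟩
  map_add' _ _ := rfl
  map_smul' _ _ := rfl

theorem inflation_injective {F G : Type*} [Group F] [TopologicalSpace F] [Group G]
    [TopologicalSpace G] {f : F →ₜ* G} (hf : Function.Surjective f) :
    Function.Injective (inflation p f) := by
  intro χ ψ h
  refine Subtype.ext (ContinuousMap.ext fun g => ?_)
  obtain ⟨x, rfl⟩ := hf g
  exact DFunLike.congr_fun (congrArg Subtype.val h) x

/-- The restriction `Hom(F, 𝔽_p) → H¹(R, 𝔽_p)^F` to a normal subgroup `R`. -/
def restriction (p : ℕ) {F : Type*} [Group F] [TopologicalSpace F] (R : Subgroup F) [R.Normal] :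
    ctsHom p F →ₗ[ZMod p] invariantHom p R where
  toFun χ := ⟨⟨fun r => χ.1 r, χ.1.continuous.comp continuous_subtype_val⟩, fun r s => χ.2 r s,
    fun x r => by
      change χ.1 (MulAut.conjNormal x r : R) = χ.1 r
      rw [MulAut.conjNormal_apply, χ.2, χ.2, map_inv_of_mem_ctsHom χ.2]
      ring⟩
  map_add' _ _ := rfl
  map_smul' _ _ := rfl

section Twist

variable {F : Type*} [Group F] [TopologicalSpace F]

/-- The action `φ ↦ ψ = φ ∘ σ` of `σ` on `H¹(R, 𝔽_p)^F` for a `σ`-invariant normal subgroup `R`. -/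
theorem exists_sigma_invariantHom (t : SigmaAction F) (R : Subgroup F) [R.Normal]
    (hR : ∀ r ∈ R, t.sigma r ∈ R) (φ : invariantHom p R) :
    ∃ ψ : invariantHom p R, ∀ r r' : R, (r' : F) = t.sigma r → ψ.1 r = φ.1 r' := by
  have hcont : Continuous fun r : R => φ.1 ⟨t.sigma r, hR r r.2⟩ :=
    φ.1.continuous.comp ((t.sigma.continuous_toFun.comp continuous_subtype_val).subtype_mk _)
  refine ⟨⟨⟨_, hcont⟩, fun r s => ?_, fun x r => ?_⟩,
    fun r r' h => congrArg φ.1 (Subtype.ext h.symm)⟩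
  · refine Eq.trans (congrArg φ.1 (Subtype.ext ?_)) (φ.2.1 _ _)
    exact map_mul t.sigma _ _
  · refine Eq.trans (congrArg φ.1 (Subtype.ext ?_)) (φ.2.2 (t.sigma x) _)
    change t.sigma (MulAut.conjNormal x r : R) = _
    rw [MulAut.conjNormal_apply, MulAut.conjNormal_apply, map_mul, map_mul, map_inv]

/-- An invariant homomorphism on a closed normal subgroup is determined by its values on elements
whose conjugates generate the subgroup topologically. -/
theorem invariantHom_eq_zero_of_closedNormalClosure [IsTopologicalGroup F] {n : ℕ} {r : Fin n → F}
    {R : Subgroup F} [R.Normal] (hR : R = SigmaAction.closedNormalClosure r) (φ : invariantHom p R)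
    (h : ∀ i (hi : r i ∈ R), φ.1 ⟨r i, hi⟩ = 0) : φ = 0 := by
  have hRc : IsClosed (R : Set F) := hR ▸ Subgroup.isClosed_topologicalClosure _
  let K : Subgroup F :=
    { carrier := Subtype.val '' (φ.1 ⁻¹' {0})
      one_mem' := ⟨1, map_one_of_mem_invariantHom φ.2, rfl⟩
      mul_mem' := by
        rintro _ _ ⟨a, ha : φ.1 a = 0, rfl⟩ ⟨b, hb : φ.1 b = 0, rfl⟩
        exact ⟨a * b, by change φ.1 (a * b) = 0; rw [φ.2.1, ha, hb, add_zero], rfl⟩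
      inv_mem' := by
        rintro _ ⟨a, ha : φ.1 a = 0, rfl⟩
        exact ⟨a⁻¹, by
          change φ.1 a⁻¹ = 0
          rw [map_inv_of_mem_invariantHom φ.2, ha, neg_zero], rfl⟩ }
  have hKn : K.Normal := ⟨by
    rintro _ ⟨a, ha : φ.1 a = 0, rfl⟩ x
    refine ⟨MulAut.conjNormal x a, ?_, MulAut.conjNormal_apply x a⟩
    change φ.1 (MulAut.conjNormal x a) = 0
    rw [φ.2.2, ha]⟩
  have hKc : IsClosed (K : Set F) := hRc.isClosedEmbedding_subtypeVal.isClosedMap _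
    ((isClosed_discrete {(0 : ZMod p)}).preimage φ.1.continuous)
  have hle : R ≤ K := by
    rw [hR]
    refine Subgroup.topologicalClosure_minimal _ (Subgroup.normalClosure_le_normal ?_) hKc
    rintro _ ⟨i, rfl⟩
    have hi : r i ∈ R := by
      rw [hR]
      exact Subgroup.le_topologicalClosure _ (Subgroup.subset_normalClosure ⟨i, rfl⟩)
    exact ⟨⟨r i, hi⟩, h i hi, rfl⟩
  refine Subtype.ext (ContinuousMap.ext fun x => ?_)
  obtain ⟨y, hy : φ.1 y = 0, hyx⟩ := hle x.2
  rw [← Subtype.ext hyx]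
  exact hy

end Twist

theorem FreeProP.finrank_ctsHom [Fact p.Prime] (n : ℕ) :
    Module.Finite (ZMod p) (ctsHom p (FreeProP p n)) ∧
      Module.finrank (ZMod p) (ctsHom p (FreeProP p n)) = n := by
  let ev : ctsHom p (FreeProP p n) →ₗ[ZMod p] (Fin n → ZMod p) :=
    { toFun := fun χ i => χ.1 (gen p i), map_add' := fun _ _ => rfl, map_smul' := fun _ _ => rfl }
  have hinj : Function.Injective ev := by
    rw [injective_iff_map_eq_zero]
    intro χ hχ
    exact Subtype.ext (eq_zero_of_gen χ.2 fun i => congrFun hχ i)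
  have hsurj : Function.Surjective ev := fun h => by
    obtain ⟨χ, hχ, hχh⟩ := exists_ctsHom_gen h
    exact ⟨⟨χ, hχ⟩, funext hχh⟩
  let e := LinearEquiv.ofBijective ev ⟨hinj, hsurj⟩
  exact ⟨Module.Finite.equiv e.symm, by rw [e.finrank_eq, Module.finrank_fin_fun]⟩

/-- `σ` acts by `-1` on `H¹(F_n, 𝔽_p)`, since the free generators are odd. -/
theorem FreeProP.ctsHom_sigma [Fact p.Prime] {n : ℕ} {χ : C(FreeProP p n, ZMod p)}
    (hχ : χ ∈ ctsHom p (FreeProP p n)) (x : FreeProP p n) :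
    χ ((sigmaAction p n).sigma x) = -χ x := by
  let ψ : C(FreeProP p n, ZMod p) :=
    ⟨fun x => χ ((sigmaAction p n).sigma x) + χ x,
      (χ.continuous.comp (sigmaAction p n).sigma.continuous_toFun).add χ.continuous⟩
  have hψ : ψ ∈ ctsHom p (FreeProP p n) := fun x y => by
    change χ ((sigmaAction p n).sigma (x * y)) + χ (x * y) = (χ ((sigmaAction p n).sigma x) + χ x) +
      (χ ((sigmaAction p n).sigma y) + χ y)
    rw [map_mul (sigmaAction p n).sigma, hχ, hχ]
    ring
  have h0 : ψ = 0 := eq_zero_of_gen hψ fun i => by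
    change χ ((sigmaAction p n).sigma (gen p i)) + χ (gen p i) = 0
    have h1 : (sigmaAction p n).sigma (gen p i) = (gen p i)⁻¹ := gen_mem_oddPart p i
    rw [h1, map_inv_of_mem_ctsHom hχ, neg_add_cancel]
  exact eq_neg_of_add_eq_zero_left (DFunLike.congr_fun h0 x)

variable {G : Type u} [Group G] [TopologicalSpace G] [IsTopologicalGroup G]
  [hG : IsProP p G] {s : SigmaAction G}

/-- An odd presentation of `G` is the same as a `σ`-equivariant continuous surjection `F_n → G`
whose kernel is generated by odd elements as a closed normal subgroup. -/
theorem hasOddPresentation_iff (s : SigmaAction G) (n : ℕ) :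
    HasOddPresentation p s n ↔ ∃ f : FreeProP p n →ₜ* G, Function.Surjective f ∧
      (∀ x, f ((FreeProP.sigmaAction p n).sigma x) = s.sigma (f x)) ∧
      ∃ r : Fin n → FreeProP p n, (∀ i, r i ∈ (FreeProP.sigmaAction p n).oddPart) ∧
        (f : FreeProP p n →* G).ker = SigmaAction.closedNormalClosure r := by
  have := hG.compactSpace
  have := hG.totallyDisconnectedSpace
  have : T2Space G := inferInstance
  constructor
  · rintro ⟨r, hr, e, he⟩
    let f : FreeProP p n →ₜ* G :=
      ⟨(e.symm.toMulEquiv.toMonoidHom).comp (QuotientGroup.mk' _),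
        e.symm.continuous.comp QuotientGroup.continuous_mk⟩
    refine ⟨f, e.symm.surjective.comp (QuotientGroup.mk'_surjective _), fun x => ?_, r, hr, ?_⟩
    · apply e.injective
      rw [he]
      change e (e.symm _) = ((FreeProP.sigmaAction p n).quotient r hr).sigma (e (e.symm _))
      rw [e.apply_symm_apply, e.apply_symm_apply]
      rfl
    · ext x
      refine Iff.trans ?_ (QuotientGroup.eq_one_iff x)
      change e.symm (x : FreeProP p n ⧸ SigmaAction.closedNormalClosure r) = 1 ↔ _
      exact map_eq_one_iff e.symm e.symm.injective
  · rintro ⟨f, hf, hfs, r, hr, hker⟩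
    let g : FreeProP p n ⧸ SigmaAction.closedNormalClosure r →* G :=
      QuotientGroup.lift _ (f : FreeProP p n →* G) fun x hx => by rwa [← hker] at hx
    have hg : Continuous g := f.continuous_toFun.quotient_lift _
    have hbij : Function.Bijective g := by
      refine ⟨?_, fun y => ?_⟩
      · rw [injective_iff_map_eq_one]
        rintro ⟨x⟩ hx
        refine (QuotientGroup.eq_one_iff x).2 ?_
        rw [← hker]
        exact hx
      · obtain ⟨x, rfl⟩ := hf y
        exact ⟨(x : FreeProP p n ⧸ SigmaAction.closedNormalClosure r), rfl⟩
    let e : (FreeProP p n ⧸ SigmaAction.closedNormalClosure r) ≃ₜ* G :=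
      { MulEquiv.ofBijective g hbij with
        continuous_toFun := hg
        continuous_invFun := hg.continuous_symm_of_equiv_compact_to_t2
          (f := (MulEquiv.ofBijective g hbij).toEquiv) }
    refine ⟨r, hr, e.symm, fun a => ?_⟩
    obtain ⟨q, rfl⟩ := e.surjective a
    obtain ⟨x, rfl⟩ := QuotientGroup.mk_surjective q
    apply e.injective
    rw [e.apply_symm_apply, e.symm_apply_apply]
    exact (hfs x).symm

variable [Fact p.Prime]

theorem rank_HFp_one_eq (p : ℕ) [IsProP p G] :
    Module.rank (ZMod p) (HFp p G 1) = Module.rank (ZMod p) (ctsHom p G) := by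
  have := IsProP.compactSpace (p := p) (G := G)
  exact (LinearEquiv.ofBijective _ (classOne_bijective p (G := G))).rank_eq.symm

/-- The dimension count: with `R` the kernel of `F_n → G`, the space `H¹(R, 𝔽_p)^F` has dimension at
most `n`, and the kernel of its map onto `H²(G, 𝔽_p)` is the image of `Hom(F_n, 𝔽_p)`, of dimension
`n - dim H¹(G, 𝔽_p)`. -/
theorem cohomology_of_hasOddPresentation {n : ℕ} (h : HasOddPresentation p s n) :
    Module.rank (ZMod p) (HFp p G 2) ≤ Module.rank (ZMod p) (HFp p G 1) ∧
      Module.rank (ZMod p) (HFp p G 1) < Cardinal.aleph0 ∧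
      (∀ c : HFp p G 1, (sigmaOnHFp p s 1).hom c = -c) ∧
      (∀ c : HFp p G 2, (sigmaOnHFp p s 2).hom c = -c) := by
  have := hG.compactSpace
  obtain ⟨f, hf, hfs, r, hr, hker⟩ := (hasOddPresentation_iff s n).1 h
  set t := FreeProP.sigmaAction p n
  obtain ⟨hVfin, hVrank⟩ := FreeProP.finrank_ctsHom (p := p) n
  have hinf := inflation_injective (p := p) hf
  have hGfin : Module.Finite (ZMod p) (ctsHom p G) := Module.Finite.of_injective _ hinf
  have hrR : ∀ i, r i ∈ (f : FreeProP p n →* G).ker := fun i => by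
    rw [hker]
    exact Subgroup.le_topologicalClosure _ (Subgroup.subset_normalClosure ⟨i, rfl⟩)
  have htR : ∀ x ∈ (f : FreeProP p n →* G).ker, t.sigma x ∈ (f : FreeProP p n →* G).ker :=
    fun x hx => by
      change f (t.sigma x) = 1
      rw [hfs, show f x = 1 from hx, map_one]
  let ev : invariantHom p (f : FreeProP p n →* G).ker →ₗ[ZMod p] (Fin n → ZMod p) :=
    { toFun := fun φ i => φ.1 ⟨r i, hrR i⟩
      map_add' := fun _ _ => rfl
      map_smul' := fun _ _ => rfl }
  have hev : Function.Injective ev := by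
    rw [injective_iff_map_eq_zero]
    intro φ hφ
    exact invariantHom_eq_zero_of_closedNormalClosure hker φ fun i hi => congrFun hφ i
  have hWfin : Module.Finite (ZMod p) (invariantHom p (f : FreeProP p n →* G).ker) :=
    Module.Finite.of_injective ev hev
  have hWrank : Module.finrank (ZMod p) (invariantHom p (f : FreeProP p n →* G).ker) ≤ n := by
    have h1 := LinearMap.finrank_le_finrank_of_injective hev
    rwa [Module.finrank_fin_fun] at h1
  have hT := transgression_surjective hf fun c => FreeProP.exists_coboundary_eq c
  have hH2fin : Module.Finite (ZMod p) (HFp p G 2) := Module.Finite.of_surjective _ hT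
  refine ⟨?_, ?_, fun c => ?_, fun c => ?_⟩
  · rw [rank_HFp_one_eq p, ← Module.finrank_eq_rank, ← Module.finrank_eq_rank, Nat.cast_le]
    let T := transgression (p := p) hf
    let ρ := restriction p (f : FreeProP p n →* G).ker
    have h1 := T.finrank_range_add_finrank_ker
    have h2 := ρ.finrank_range_add_finrank_ker
    rw [LinearMap.range_eq_top.2 hT, finrank_top] at h1
    have h3 : Module.finrank (ZMod p) (LinearMap.range ρ) ≤
        Module.finrank (ZMod p) (LinearMap.ker T) := by
      refine Submodule.finrank_mono ?_
      rintro _ ⟨χ, rfl⟩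
      exact (transgression_eq_zero_iff hf _).2 ⟨χ.1, χ.2, fun _ => rfl⟩
    have h4 : Module.finrank (ZMod p) (LinearMap.ker ρ) ≤ Module.finrank (ZMod p) (ctsHom p G) := by
      rw [← LinearMap.finrank_range_of_inj hinf]
      refine Submodule.finrank_mono fun χ hχ => ?_
      have hχ' : ∀ r : (f : FreeProP p n →* G).ker, χ.1 r = 0 := fun r =>
        DFunLike.congr_fun (congrArg Subtype.val (show ρ χ = 0 from hχ)) r
      obtain ⟨a, ha⟩ := exists_comp_eq_of_forall_ker hf χ.1 fun x r => by
        rw [χ.2, hχ', add_zero]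
      refine ⟨⟨a, fun g g' => ?_⟩, Subtype.ext (ContinuousMap.ext ha)⟩
      obtain ⟨x, rfl⟩ := hf g
      obtain ⟨y, rfl⟩ := hf g'
      rw [← map_mul, ha, ha, ha, χ.2]
    omega
  · rw [rank_HFp_one_eq p]
    exact Module.rank_lt_aleph0 _ _
  · obtain ⟨χ, rfl⟩ := (classOne_bijective p (G := G)).2 c
    rw [← map_neg]
    refine sigmaOnHFp_classOne s χ (-χ) fun g => ?_
    obtain ⟨x, rfl⟩ := hf g
    rw [← hfs]
    exact (FreeProP.ctsHom_sigma (inflation p f χ).2 x).symm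
  · obtain ⟨φ, rfl⟩ := hT c
    rw [← map_neg]
    obtain ⟨ψ, hψ⟩ := exists_sigma_invariantHom t _ htR φ
    have h0 : ψ + φ = 0 := invariantHom_eq_zero_of_closedNormalClosure hker _ fun i hi => by
      change ψ.1 ⟨r i, hi⟩ + φ.1 ⟨r i, hi⟩ = 0
      rw [hψ ⟨r i, hi⟩ (⟨r i, hi⟩⁻¹) (hr i).symm, map_inv_of_mem_invariantHom φ.2, neg_add_cancel]
    rw [← eq_neg_of_add_eq_zero_left h0]
    exact sigmaOnHFp_transgression hf t s hfs φ ψ hψ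

/-- Odd elements `g_1, …, g_d` of `G` dual to a basis of `H¹(G, 𝔽_p)` define a `σ`-equivariant
surjection `F_d → G`. -/
theorem exists_surjective_of_sigma_eq_neg (hp : 2 < p) {d : ℕ}
    (hfin : Module.Finite (ZMod p) (ctsHom p G))
    (hd : Module.finrank (ZMod p) (ctsHom p G) ≤ d)
    (hσ : ∀ χ ∈ ctsHom p G, ∀ x, χ (s.sigma x) = -χ x) :
    ∃ f : FreeProP p d →ₜ* G, Function.Surjective f ∧
      ∀ x, f ((FreeProP.sigmaAction p d).sigma x) = s.sigma (f x) := by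
  have := hG.compactSpace
  have := hG.totallyDisconnectedSpace
  have : T2Space G := inferInstance
  let ev : s.oddPart → Module.Dual (ZMod p) (ctsHom p G) := fun g =>
    { toFun := fun χ => χ.1 g, map_add' := fun _ _ => rfl, map_smul' := fun _ _ => rfl }
  obtain ⟨g, hg⟩ := exists_fin_forall_eq_zero ev (fun χ hχ => by
    refine Subtype.ext (ContinuousMap.ext fun x => ?_)
    -- The element `x (σ x)⁻¹` is odd, and `χ` takes the value `2 χ x` there.
    have h1 : χ.1 (x * (s.sigma x)⁻¹) = 0 := hχ ⟨x * (s.sigma x)⁻¹, by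
      change s.sigma (x * (s.sigma x)⁻¹) = (x * (s.sigma x)⁻¹)⁻¹
      rw [map_mul, map_inv, s.sigma_sigma, mul_inv_rev, inv_inv]⟩
    rw [χ.2, map_inv_of_mem_ctsHom χ.2, hσ χ.1 χ.2, neg_neg] at h1
    exact ZMod.eq_zero_of_add_self hp h1) hd
    ⟨1, by change s.sigma 1 = 1⁻¹; rw [map_one, inv_one]⟩
  obtain ⟨f, hf, -⟩ := FreeProP.existsUnique_hom p d fun j => (g j : G)
  refine ⟨f, ?_, ?_⟩
  · have hcl : IsClosed ((f : FreeProP p d →* G).range : Set G) :=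
      (isCompact_range f.continuous_toFun).isClosed
    refine MonoidHom.range_eq_top.1 (eq_top_of_forall_ctsHom (p := p) hcl fun χ hχ h => ?_)
    exact congrArg Subtype.val (hg ⟨χ, hχ⟩ fun j => h _ ⟨FreeProP.gen p j, hf j⟩)
  · obtain ⟨f', -, hf'⟩ := FreeProP.existsUnique_hom p d fun j => (g j : G)⁻¹
    have e1 := hf' (f.comp (FreeProP.sigmaAction p d).sigma) fun j => by
      change f ((FreeProP.sigmaAction p d).sigma (FreeProP.gen p j)) = _
      have h3 : (FreeProP.sigmaAction p d).sigma (FreeProP.gen p j) = (FreeProP.gen p j)⁻¹ :=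
        FreeProP.gen_mem_oddPart p j
      rw [h3, map_inv, hf]
    have e2 := hf' (s.sigma.comp f) fun j => by
      change s.sigma (f (FreeProP.gen p j)) = _
      rw [hf]
      exact (g j).2
    exact fun x => DFunLike.congr_fun (e1.trans e2.symm) x

/-- With `R` the kernel of a `σ`-equivariant surjection `F_d → G` inducing an isomorphism on `H¹`,
the transgression embeds `H¹(R, 𝔽_p)^F` into `H²(G, 𝔽_p)`, so that `d` odd elements of `R` detect
`H¹(R, 𝔽_p)^F` and hence generate `R` as a closed normal subgroup. -/
theorem hasOddPresentation_of_cohomology (hp : 2 < p)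
    (h21 : Module.rank (ZMod p) (HFp p G 2) ≤ Module.rank (ZMod p) (HFp p G 1))
    (h1fin : Module.rank (ZMod p) (HFp p G 1) < Cardinal.aleph0)
    (hσ1 : ∀ c : HFp p G 1, (sigmaOnHFp p s 1).hom c = -c)
    (hσ2 : ∀ c : HFp p G 2, (sigmaOnHFp p s 2).hom c = -c) :
    HasOddPresentation p s (dGen p G) := by
  have := hG.compactSpace
  have := hG.totallyDisconnectedSpace
  have : T2Space G := inferInstance
  have hH1fin : Module.Finite (ZMod p) (HFp p G 1) := Module.rank_lt_aleph0_iff.1 h1fin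
  have hH2fin : Module.Finite (ZMod p) (HFp p G 2) :=
    Module.rank_lt_aleph0_iff.1 (h21.trans_lt h1fin)
  let e := LinearEquiv.ofBijective _ (classOne_bijective p (G := G))
  have hVfin : Module.Finite (ZMod p) (ctsHom p G) := Module.Finite.equiv e.symm
  have hV : Module.finrank (ZMod p) (ctsHom p G) = dGen p G := e.finrank_eq
  have hH2 : Module.finrank (ZMod p) (HFp p G 2) ≤ dGen p G := by
    rw [← Module.finrank_eq_rank, ← Module.finrank_eq_rank, Nat.cast_le] at h21
    exact h21
  generalize dGen p G = d at hV hH2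
  have hσ : ∀ χ ∈ ctsHom p G, ∀ x, χ (s.sigma x) = -χ x := by
    intro χ hχ x
    let ψ := inflation p s.sigma ⟨χ, hχ⟩
    have h3 : classOne p ψ = classOne p (-⟨χ, hχ⟩) := by
      rw [← sigmaOnHFp_classOne s ⟨χ, hχ⟩ ψ fun x => rfl, hσ1, map_neg]
    exact DFunLike.congr_fun (congrArg Subtype.val ((classOne_bijective p (G := G)).1 h3)) x
  obtain ⟨f, hf, hfs⟩ := exists_surjective_of_sigma_eq_neg hp hVfin hV.le hσ
  set t := FreeProP.sigmaAction p d
  have htR : ∀ x ∈ (f : FreeProP p d →* G).ker, t.sigma x ∈ (f : FreeProP p d →* G).ker :=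
    fun x hx => by
      change f (t.sigma x) = 1
      rw [hfs, show f x = 1 from hx, map_one]
  -- Inflation is an isomorphism on `H¹`, so that the transgression is injective.
  have hT : Function.Injective (transgression (p := p) hf) := by
    obtain ⟨hFfin, hFrank⟩ := FreeProP.finrank_ctsHom (p := p) d
    have hsurj : Function.Surjective (inflation p f) :=
      (LinearMap.injective_iff_surjective_of_finrank_eq_finrank (hV.trans hFrank.symm)).1
        (inflation_injective hf)
    rw [injective_iff_map_eq_zero]
    intro φ hφ
    obtain ⟨χ, hχ, hχφ⟩ := (transgression_eq_zero_iff hf φ).1 hφ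
    obtain ⟨χ', hχ'⟩ := hsurj ⟨χ, hχ⟩
    refine Subtype.ext (ContinuousMap.ext fun r => ?_)
    have h3 : χ'.1 (f r) = χ (r : FreeProP p d) :=
      DFunLike.congr_fun (congrArg Subtype.val hχ') (r : FreeProP p d)
    rw [← hχφ, ← h3, show f r = 1 from r.2]
    exact map_one_of_mem_ctsHom χ'.2
  have hWfin : Module.Finite (ZMod p) (invariantHom p (f : FreeProP p d →* G).ker) :=
    Module.Finite.of_injective _ hT
  have hWrank : Module.finrank (ZMod p) (invariantHom p (f : FreeProP p d →* G).ker) ≤ d :=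
    (LinearMap.finrank_le_finrank_of_injective hT).trans hH2
  have hσR : ∀ (φ : invariantHom p (f : FreeProP p d →* G).ker)
      (r r' : (f : FreeProP p d →* G).ker), (r' : FreeProP p d) = t.sigma r →
      φ.1 r' = -φ.1 r := by
    intro φ r r' hr
    obtain ⟨ψ, hψ⟩ := exists_sigma_invariantHom t _ htR φ
    have h3 : transgression hf ψ = transgression hf (-φ) := by
      rw [← sigmaOnHFp_transgression hf t s hfs φ ψ hψ, hσ2, map_neg]
    rw [← hψ r r' hr, hT h3]
    rfl
  let ev : {r : (f : FreeProP p d →* G).ker // (r : FreeProP p d) ∈ t.oddPart} →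
      Module.Dual (ZMod p) (invariantHom p (f : FreeProP p d →* G).ker) := fun r =>
    { toFun := fun φ => φ.1 r.1, map_add' := fun _ _ => rfl, map_smul' := fun _ _ => rfl }
  obtain ⟨r, hr⟩ := exists_fin_forall_eq_zero ev (fun φ hφ => by
    refine Subtype.ext (ContinuousMap.ext fun x => ?_)
    let x' : (f : FreeProP p d →* G).ker := ⟨t.sigma x, htR x x.2⟩
    have h1 : φ.1 (x * x'⁻¹) = 0 := hφ ⟨x * x'⁻¹, by
      change t.sigma (x * (t.sigma x)⁻¹) = (x * (t.sigma x)⁻¹ : FreeProP p d)⁻¹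
      rw [map_mul, map_inv, t.sigma_sigma, mul_inv_rev, inv_inv]⟩
    rw [φ.2.1, map_inv_of_mem_invariantHom φ.2, hσR φ x x' rfl, neg_neg] at h1
    exact ZMod.eq_zero_of_add_self hp h1) hWrank
    ⟨1, by change t.sigma 1 = 1⁻¹; rw [map_one, inv_one]⟩
  refine (hasOddPresentation_iff s d).2 ⟨f, hf, hfs, fun i => (r i).1, fun i => (r i).2, ?_⟩
  refine le_antisymm ?_ ?_
  · refine le_of_forall_invariantHom (p := p) (Subgroup.isClosed_topologicalClosure _)
      fun φ hφ h => ?_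
    refine congrArg Subtype.val (hr ⟨φ, hφ⟩ fun j => h _ ?_)
    exact Subgroup.le_topologicalClosure _ (Subgroup.subset_normalClosure ⟨j, rfl⟩)
  · refine Subgroup.topologicalClosure_minimal _ (Subgroup.normalClosure_le_normal ?_) ?_
    · rintro _ ⟨i, rfl⟩
      exact (r i).1.2
    · exact isClosed_singleton.preimage f.continuous_toFun

end OddPresentation

theorem mainTheorem9 (p : ℕ) [Fact p.Prime] (hp : 2 < p)
    {G : Type*} [Group G] [TopologicalSpace G] [IsTopologicalGroup G] [IsProP p G]
    (s : SigmaAction G) :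
    ((∃ n : ℕ, HasOddPresentation p s n) ↔
      (Module.rank (ZMod p) (HFp p G 2) ≤ Module.rank (ZMod p) (HFp p G 1) ∧
        Module.rank (ZMod p) (HFp p G 1) < Cardinal.aleph0 ∧
        (∀ c : HFp p G 1, (sigmaOnHFp p s 1).hom c = -c) ∧
        (∀ c : HFp p G 2, (sigmaOnHFp p s 2).hom c = -c))) ∧
    ((∃ n : ℕ, HasOddPresentation p s n) → HasOddPresentation p s (dGen p G)) := by
  have hab := fun h : ∃ n : ℕ, HasOddPresentation p s n =>
    cohomology_of_hasOddPresentation h.choose_spec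
  have hba := fun h : _ ∧ _ ∧ _ ∧ _ =>
    hasOddPresentation_of_cohomology (p := p) (s := s) hp h.1 h.2.1 h.2.2.1 h.2.2.2
  exact ⟨⟨hab, fun h => ⟨_, hba h⟩⟩, fun h => hba (hab h)⟩
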